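/- All graphs are finite and simple. A \emph{circuit} of a graph is a subgraph that is a single vertex, a single edge together with its two end vertices, or a cycle. A circuit is \emph{separating} if deleting its vertices from the graph increases the number of connected components, and \emph{non-separating} otherwise. A \emph{triangulation} is a graph that can be drawn in the plane without crossings so that every face, including the outer one, is bounded by a triangle. A graph is \emph{Hamiltonian} if it has a Hamiltonian cycle; the one-vertex graph also counts as Hamiltonian. (1) Let $G$ be a planar graph with $n$ vertices that has a non-separating circuit with $k$ vertices, where $(n,k)\neq(2,2)$. Then $G$ is a minor of a Hamiltonian planar graph with at most $2n-k$ vertices. (2) Every triangulation with $n\ge 4$ vertices is a minor of a Hamiltonian planar graph with at most $2n-4$ vertices. -/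

import Mathlib

namespace PlanarMinor

/-- The Euclidean plane. -/
abbrev Plane : Type := EuclideanSpace ℝ (Fin 2)

/-- A simple polygonal arc in the plane: a chain of `len ≥ 1` nondegenerate straight segments
`[pt i, pt (i + 1)]`, `i < len`, in which consecutive segments share exactly their common
endpoint and nonconsecutive ones are disjoint (so that the union is homeomorphic to `[0, 1]`).
The values `pt i` with `i > len` play no role. -/
structure PolyArc where
  len : ℕ
  len_pos : 0 < len
  pt : ℕ → Plane
  nondegenerate : ∀ i < len, pt i ≠ pt (i + 1)
  consecutive : ∀ i, i + 1 < len →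
    segment ℝ (pt i) (pt (i + 1)) ∩ segment ℝ (pt (i + 1)) (pt (i + 2)) = {pt (i + 1)}
  nonconsecutive : ∀ i j, i + 1 < j → j < len →
    Disjoint (segment ℝ (pt i) (pt (i + 1))) (segment ℝ (pt j) (pt (j + 1)))

namespace PolyArc

/-- The point set of the arc. -/
def trace (γ : PolyArc) : Set Plane :=
  ⋃ i ∈ Set.Iio γ.len, segment ℝ (γ.pt i) (γ.pt (i + 1))

/-- The unordered pair of end points of the arc. -/
def ends (γ : PolyArc) : Sym2 Plane :=
  s(γ.pt 0, γ.pt γ.len)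

end PolyArc

/-- A drawing of the graph `G` in the plane without crossings: distinct vertices are distinct
points, every edge is a simple polygonal arc joining its two ends and containing no other
vertex, and two distinct edges meet in common ends only. -/
structure PlaneDrawing {V : Type*} (G : SimpleGraph V) where
  pos : V → Plane
  pos_injective : Function.Injective pos
  arc : G.edgeSet → PolyArc
  arc_ends : ∀ e : G.edgeSet, (arc e).ends = (e : Sym2 V).map pos
  vertex_mem_arc : ∀ (e : G.edgeSet) (v : V), pos v ∈ (arc e).trace → v ∈ (e : Sym2 V)
  arc_inter : ∀ e f : G.edgeSet, e ≠ f → ∀ x ∈ (arc e).trace ∩ (arc f).trace,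
    ∃ v : V, v ∈ (e : Sym2 V) ∧ v ∈ (f : Sym2 V) ∧ x = pos v

namespace PlaneDrawing

variable {V : Type*} {G : SimpleGraph V}

/-- The set of all points of the plane that lie on a vertex or an edge of the drawing. -/
def carrier (D : PlaneDrawing G) : Set Plane :=
  Set.range D.pos ∪ ⋃ e, (D.arc e).trace

/-- `F` is a face of the drawing: a connected component of the complement of the drawing.
The unbounded (outer) face is included. -/
def IsFace (D : PlaneDrawing G) (F : Set Plane) : Prop :=
  ∃ x ∈ D.carrierᶜ, F = connectedComponentIn D.carrierᶜ x

/-- `S` is the point set of a triangle (a cycle of length three) of the drawn graph. -/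
def IsTriangle (D : PlaneDrawing G) (S : Set Plane) : Prop :=
  ∃ (a b c : V) (hab : G.Adj a b) (hbc : G.Adj b c) (hca : G.Adj c a),
    S = (D.arc ⟨s(a, b), hab⟩).trace ∪ (D.arc ⟨s(b, c), hbc⟩).trace ∪
      (D.arc ⟨s(c, a), hca⟩).trace

end PlaneDrawing

/-- A graph is planar if it can be drawn in the plane without crossings. -/
def IsPlanar {V : Type*} (G : SimpleGraph V) : Prop :=
  Nonempty (PlaneDrawing G)

/-- A (planar) triangulation: a graph with a drawing in the plane without crossings in which
every face, the outer one included, is bounded by a triangle of the graph. -/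
def IsTriangulation {V : Type*} (G : SimpleGraph V) : Prop :=
  ∃ D : PlaneDrawing G, ∀ F, D.IsFace F → D.IsTriangle (frontier F)

/-- `G` is a minor of `H`: there are pairwise disjoint branch sets in `H`, one for each vertex
of `G`, each inducing a (nonempty) connected subgraph of `H`, such that the branch sets of
adjacent vertices of `G` are joined by an edge of `H`. Equivalently, `G` arises from `H` by
vertex deletions, edge deletions and edge contractions. -/
def IsMinor {V W : Type*} (G : SimpleGraph V) (H : SimpleGraph W) : Prop :=
  ∃ B : V → Set W,
    (∀ v, (H.induce (B v)).Connected) ∧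
    (∀ u v, u ≠ v → Disjoint (B u) (B v)) ∧
    ∀ u v, G.Adj u v → ∃ x ∈ B u, ∃ y ∈ B v, H.Adj x y

/-- A circuit: a subgraph that is a single vertex, or a single edge with its two ends, or a
cycle. -/
def IsCircuit {V : Type*} {G : SimpleGraph V} (O : G.Subgraph) : Prop :=
  (∃ v, O = G.singletonSubgraph v) ∨
  (∃ (u v : V) (h : G.Adj u v), O = G.subgraphOfAdj h) ∨
  (∃ (v : V) (p : G.Walk v v), p.IsCycle ∧ O = p.toSubgraph)

/-- The subgraph `O` of the finite graph `G` is separating if deleting (the vertices of) `O`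
from `G` increases the number of connected components. -/
def IsSeparating {V : Type*} [Finite V] {G : SimpleGraph V} (O : G.Subgraph) : Prop :=
  Nat.card G.ConnectedComponent < Nat.card (G.induce O.vertsᶜ).ConnectedComponent

end PlanarMinor

namespace PlanarMinor

open Set Filter Topology

/-! Add edges to `G` until it is maximal planar; cycles of `G` remain cycles, and the graph becomes
connected. Let C be a cycle in a connected planar graph that misses some vertex. Then some w off C
is adjacent to some x on C; let a and b be the neighbours of x on C. Split x into two adjacent
copies along the edges xw and xa, so that w and a become adjacent to both copies. The result is
planar, and contracting the new edge gives back the old graph. One copy is still adjacent to b, so C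
can be rerouted as a, ..., b, that copy, w, the other copy, a. Each split adds one vertex to the
graph and two to the cycle, so n - k splits turn a cycle of length k into a Hamiltonian cycle of a
planar graph with 2n - k vertices (`exists_hamiltonian_of_cycleList`).

In a maximal planar graph consecutive neighbours of a vertex are adjacent
(`IsMaximalPlanar.exists_order`). This yields a triangle if n ≥ 3, which serves for circuits with
one or two vertices, and a 4-cycle if n ≥ 4, which gives the second part.

What remains is that planarity survives minors, vertex splits and the joining of separate parts. All
of this is reduced to straight-line drawings. Cutting arcs at their bends makes a planar graph a
minor of a straight-line graph (`PlaneDrawing.exists_straight_model`). There, splitting a vertex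
means moving a copy of it slightly into a convex cone (`IsStraight.splitVertex_of_cone`).
Conversely, a minor of a straight-line graph is planar (`IsStraight.isPlanar_of_isMinor`): repeated
splits thin the branch sets to subdivided stars (`exists_star_model`), and the paths between their
centres are polygonal arcs. -/

/-- A crossing-free straight-line drawing of `K` in the complex plane. -/
structure StraightDrawing {X : Type*} (K : SimpleGraph X) where
  pos : X → ℂ
  inj : Function.Injective pos
  notMem : ∀ a b v, K.Adj a b → v ≠ a → v ≠ b → pos v ∉ segment ℝ (pos a) (pos b)
  disj : ∀ a b c d, K.Adj a b → K.Adj c d → a ≠ c → a ≠ d → b ≠ c → b ≠ d →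
    Disjoint (segment ℝ (pos a) (pos b)) (segment ℝ (pos c) (pos d))

/-- `K` has a crossing-free straight-line drawing. -/
def IsStraight {X : Type*} (K : SimpleGraph X) : Prop := Nonempty (StraightDrawing K)

theorem IsStraight.mono {X : Type*} {K L : SimpleGraph X} (h : K ≤ L) (hL : IsStraight L) :
    IsStraight K := by
  obtain ⟨D⟩ := hL
  exact ⟨⟨D.pos, D.inj, fun a b v hab => D.notMem a b v (h hab),
    fun a b c d hab hcd => D.disj a b c d (h hab) (h hcd)⟩⟩

theorem IsStraight.comap {X Y : Type*} {L : SimpleGraph Y} (hL : IsStraight L) (f : X → Y)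
    (hf : Function.Injective f) : IsStraight (L.comap f) := by
  obtain ⟨D⟩ := hL
  exact ⟨⟨D.pos ∘ f, D.inj.comp hf,
    fun a b v hab h1 h2 => D.notMem _ _ _ hab (hf.ne h1) (hf.ne h2),
    fun a b c d hab hcd h1 h2 h3 h4 =>
      D.disj _ _ _ _ hab hcd (hf.ne h1) (hf.ne h2) (hf.ne h3) (hf.ne h4)⟩⟩

/-! ### Splitting a vertex of a straight-line drawing. -/

/-- The graph obtained from `K` by splitting the vertex `y` into two adjacent vertices: `y` itself,
which keeps its neighbours in `S`, and a new vertex `none`, which takes over those in `T`. -/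
def splitVertex {X : Type*} (K : SimpleGraph X) (y : X) (S T : Set X) :
    SimpleGraph (Option X) where
  Adj
    | some a, some b => K.Adj a b ∧ (a = y → b ∈ S) ∧ (b = y → a ∈ S)
    | some a, none => a = y ∨ (K.Adj y a ∧ a ∈ T)
    | none, some a => a = y ∨ (K.Adj y a ∧ a ∈ T)
    | none, none => False
  symm := ⟨by
    rintro (_ | a) (_ | b) h
    · exact h
    · exact h
    · exact h
    · exact ⟨h.1.symm, h.2.2, h.2.1⟩⟩
  loopless := ⟨by
    rintro (_ | a) h
    · exact h
    · exact h.1.ne rfl⟩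

section

variable {X : Type*} {K : SimpleGraph X} {y : X} {S T : Set X}

theorem splitVertex_mono {S' T' : Set X} (hS : S ∩ K.neighborSet y ⊆ S')
    (hT : T ∩ K.neighborSet y ⊆ T') : splitVertex K y S T ≤ splitVertex K y S' T' := by
  rintro (_ | a) (_ | b) h
  · exact h
  · exact h.imp id fun h => ⟨h.1, hT ⟨h.2, h.1⟩⟩
  · exact h.imp id fun h => ⟨h.1, hT ⟨h.2, h.1⟩⟩
  · refine ⟨h.1, fun e => hS ⟨h.2.1 e, ?_⟩, fun e => hS ⟨h.2.2 e, ?_⟩⟩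
    · subst e; exact h.1
    · subst e; exact h.1.symm

open Classical in
/-- Exchanging the two copies of the split vertex. -/
theorem IsStraight.splitVertex_swap (h : IsStraight (splitVertex K y S T)) :
    IsStraight (splitVertex K y T S) := by
  refine (h.comap (Equiv.swap none (some y)) (Equiv.injective _)).mono ?_
  have h1 : Equiv.swap none (some y) none = some y := Equiv.swap_apply_left _ _
  have h2 : Equiv.swap none (some y) (some y) = none := Equiv.swap_apply_right _ _
  have h3 : ∀ a, a ≠ y → Equiv.swap none (some y) (some a) = some a := fun a ha =>
    Equiv.swap_apply_of_ne_of_ne (by simp) (by simpa using ha)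
  have key : ∀ a, (splitVertex K y T S).Adj none (some a) →
      (splitVertex K y S T).Adj (Equiv.swap none (some y) none)
        (Equiv.swap none (some y) (some a)) := by
    intro a hab
    rw [h1]
    by_cases ha : a = y
    · subst ha; rw [h2]; exact Or.inl rfl
    · rw [h3 a ha]
      obtain h | h := hab
      · exact absurd h ha
      · exact ⟨h.1, fun _ => h.2, fun e => absurd e ha⟩
  rintro (_ | a) (_ | b) hab
  · exact hab.elim
  · exact key b hab
  · exact (key a hab.symm).symm
  · change (splitVertex K y S T).Adj _ _
    by_cases ha : a = y
    · subst ha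
      rw [h2, h3 b hab.1.ne']
      exact Or.inr ⟨hab.1, hab.2.1 rfl⟩
    · by_cases hb : b = y
      · subst hb
        rw [h2, h3 a ha]
        exact Or.inr ⟨hab.1.symm, hab.2.2 rfl⟩
      · rw [h3 a ha, h3 b hb]
        exact ⟨hab.1, fun e => absurd e ha, fun e => absurd e hb⟩

end

/-- The segment is compact, so a whole thickening of it misses `C`, and for small `ε` the perturbed
segment stays inside that thickening. -/
theorem eventually_disjoint_segment {y d e : ℂ} {C : Set ℂ} (hC : IsClosed C)
    (h : Disjoint (segment ℝ y e) C) :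
    ∀ᶠ ε : ℝ in 𝓝[>] 0, Disjoint (segment ℝ (y + ε • d) e) C := by
  have hcpt : IsCompact (segment ℝ y e) := by
    rw [segment_eq_image_lineMap]
    exact isCompact_Icc.image (by fun_prop)
  obtain ⟨δ, hδ, hsub⟩ := hcpt.exists_thickening_subset_open hC.isOpen_compl
    (fun z hz hz' => Set.disjoint_left.1 h hz hz')
  have hlim : Tendsto (fun ε : ℝ => ‖ε • d‖) (𝓝[>] 0) (𝓝 0) := by
    have : Continuous fun ε : ℝ => ‖ε • d‖ := by fun_prop
    have h0 := this.tendsto 0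
    simp only [zero_smul, norm_zero] at h0
    exact h0.mono_left nhdsWithin_le_nhds
  filter_upwards [hlim.eventually_lt_const hδ] with ε hε
  rw [Set.disjoint_left]
  rintro z ⟨s, t, hs, ht, hst, rfl⟩ hz
  refine hsub ?_ hz
  rw [Metric.mem_thickening_iff]
  refine ⟨s • y + t • e, ⟨s, t, hs, ht, hst, rfl⟩, ?_⟩
  rw [dist_eq_norm]
  have : s • (y + ε • d) + t • e - (s • y + t • e) = s • (ε • d) := by
    rw [smul_add]; abel
  rw [this, norm_smul, Real.norm_of_nonneg hs]
  calc s * ‖ε • d‖ ≤ 1 * ‖ε • d‖ := by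
        gcongr; linarith
    _ < δ := by simpa using hε

theorem isClosed_segment (a b : ℂ) : IsClosed (segment ℝ a b) := by
  rw [segment_eq_image_lineMap]
  exact (isCompact_Icc.image (by fun_prop)).isClosed

/-- Splitting a vertex of a straight-line drawing along a convex cone `{f ≥ 0, g ≥ 0}`. -/
theorem IsStraight.splitVertex_of_cone {X : Type*} [Finite X] {K : SimpleGraph X}
    (D : StraightDrawing K) (y : X) (f g : ℂ →ₗ[ℝ] ℝ) (d : ℂ) (hf : 0 < f d) (hg : 0 < g d) :
    IsStraight (splitVertex K y
      {e | ¬ (0 < f (D.pos e - D.pos y) ∧ 0 < g (D.pos e - D.pos y))}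
      {e | 0 ≤ f (D.pos e - D.pos y) ∧ 0 ≤ g (D.pos e - D.pos y)}) := by
  -- One `ε` serves for all of the finitely many disjointness relations. The degenerate cases `e =
  -- y` and `a = b` are included, so that single points are covered too.
  have hev : ∀ᶠ ε : ℝ in 𝓝[>] 0, ∀ e a b : X,
      Disjoint (segment ℝ (D.pos y) (D.pos e)) (segment ℝ (D.pos a) (D.pos b)) →
      Disjoint (segment ℝ (D.pos y + ε • d) (D.pos e)) (segment ℝ (D.pos a) (D.pos b)) := by
    simp only [eventually_all]
    intro e a b h
    exact eventually_disjoint_segment (isClosed_segment _ _) h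
  obtain ⟨ε, hε, hε0⟩ := (hev.and self_mem_nhdsWithin).exists
  replace hε0 : 0 < ε := hε0
  set y' := D.pos y + ε • d with hy'
  -- the new vertex is off closed sets missing `y`
  have hd1 : ∀ a b, D.pos y ∉ segment ℝ (D.pos a) (D.pos b) →
      Disjoint (segment ℝ y' (D.pos y)) (segment ℝ (D.pos a) (D.pos b)) := by
    intro a b h
    apply hε
    rw [segment_same]
    exact Set.disjoint_singleton_left.2 h
  have hd2 : ∀ e z, D.pos z ∉ segment ℝ (D.pos y) (D.pos e) →
      D.pos z ∉ segment ℝ y' (D.pos e) := by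
    intro e z h
    have := hε e z z (by rw [segment_same]; exact Set.disjoint_singleton_right.2 h)
    rw [segment_same] at this
    exact Set.disjoint_singleton_right.1 this
  have hne : ∀ z, z ≠ y → D.pos z ∉ segment ℝ y' (D.pos y) := by
    intro z hz
    apply hd2
    rw [segment_same]
    exact fun h => hz (D.inj h)
  -- rays from `y` outside the open cone never meet segments from the new vertex into the cone
  have hcone : ∀ e F : ℂ, 0 ≤ f (e - D.pos y) ∧ 0 ≤ g (e - D.pos y) →
      ¬ (0 < f (F - D.pos y) ∧ 0 < g (F - D.pos y)) →
      ∀ z, z ∈ segment ℝ y' e → z ∈ segment ℝ (D.pos y) F → z = e := by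
    rintro e F ⟨h1, h2⟩ hF z ⟨s, t, hs, ht, hst, rfl⟩ ⟨s', t', hs', ht', hst', hz⟩
    rcases hs.eq_or_lt with rfl | hs
    · have : t = 1 := by linarith
      simp [this]
    · exfalso
      -- Unless the common point is `e`, its difference from `y` is a positive multiple of `d` plus
      -- a vector of the closed cone, hence lies in the open cone. It is also a nonnegative multiple
      -- of `F - y`, which would put `F` in the open cone.
      have h3 : t' • (F - D.pos y) = (s * ε) • d + t • (e - D.pos y) := by
        have e1 : s' = 1 - t' := by linarith
        have e2 : t = 1 - s := by linarith
        subst e1 e2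
        rw [hy'] at hz
        simp only [Complex.real_smul, Complex.ofReal_sub, Complex.ofReal_one,
          Complex.ofReal_mul] at hz ⊢
        linear_combination hz
      have h4 := congrArg f h3
      have h5 := congrArg g h3
      simp only [map_add, map_smul, smul_eq_mul] at h4 h5
      have h6 : 0 < t' * f (F - D.pos y) := by rw [h4]; positivity
      have h7 : 0 < t' * g (F - D.pos y) := by rw [h5]; positivity
      exact hF ⟨pos_of_mul_pos_right h6 ht', pos_of_mul_pos_right h7 ht'⟩
  have hyself : ¬ (0 < f (D.pos y - D.pos y) ∧ 0 < g (D.pos y - D.pos y)) := by simp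
  have hyout : ∀ F : ℂ, ¬ (0 < f (F - D.pos y) ∧ 0 < g (F - D.pos y)) →
      y' ∉ segment ℝ (D.pos y) F := by
    rintro F hF ⟨s, t, hs, ht, hst, hz⟩
    have h3 : t • (F - D.pos y) = ε • d := by
      have e1 : s = 1 - t := by linarith
      subst e1
      rw [hy'] at hz
      simp only [Complex.real_smul, Complex.ofReal_sub, Complex.ofReal_one] at hz ⊢
      linear_combination hz
    have h4 := congrArg f h3
    have h5 := congrArg g h3
    simp only [map_smul, smul_eq_mul] at h4 h5
    have h6 : 0 < t * f (F - D.pos y) := by rw [h4]; positivity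
    have h7 : 0 < t * g (F - D.pos y) := by rw [h5]; positivity
    exact hF ⟨pos_of_mul_pos_right h6 ht, pos_of_mul_pos_right h7 ht⟩
  set S := {e | ¬ (0 < f (D.pos e - D.pos y) ∧ 0 < g (D.pos e - D.pos y))} with hS
  set T := {e | 0 ≤ f (D.pos e - D.pos y) ∧ 0 ≤ g (D.pos e - D.pos y)} with hT
  let pos' : Option X → ℂ := fun o => o.elim y' D.pos
  have hinj0 : ∀ a, D.pos a ≠ y' := by
    intro a h
    by_cases ha : a = y
    · subst ha
      exact hyout (D.pos a) hyself (by rw [segment_same]; exact h.symm)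
    · exact hne a ha (h ▸ left_mem_segment _ _ _)
  have hinj : Function.Injective pos' := by
    rintro (_ | a) (_ | b) h
    · rfl
    · exact absurd h.symm (hinj0 b)
    · exact absurd h (hinj0 a)
    · exact congrArg some (D.inj h)
  -- edges at the new vertex contain no old vertex
  have hnm1 : ∀ a v, a = y ∨ (K.Adj y a ∧ a ∈ T) → v ≠ a →
      D.pos v ∉ segment ℝ y' (D.pos a) := by
    rintro a v (rfl | ⟨ha, haT⟩) hva
    · exact hne v hva
    · by_cases hv : v = y
      · subst hv
        intro h
        exact ha.ne (D.inj (hcone _ _ haT hyself _ h (left_mem_segment _ _ _)))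
      · exact hd2 _ _ (D.notMem _ _ _ ha hv hva)
  -- old edges do not contain the new vertex
  have hnm2 : ∀ a b, (splitVertex K y S T).Adj (some a) (some b) →
      y' ∉ segment ℝ (D.pos a) (D.pos b) := by
    rintro a b ⟨hab, h1, h2⟩
    by_cases ha : a = y
    · subst ha; exact hyout _ (h1 rfl)
    by_cases hb : b = y
    · subst hb; rw [segment_symm]; exact hyout _ (h2 rfl)
    · intro h
      exact Set.disjoint_left.1
        (hd1 a b (D.notMem a b y hab (Ne.symm ha) (Ne.symm hb))) (left_mem_segment _ _ _) h
  have hdj : ∀ e a b, (e = y ∨ (K.Adj y e ∧ e ∈ T)) →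
      (splitVertex K y S T).Adj (some a) (some b) → e ≠ a → e ≠ b →
      Disjoint (segment ℝ y' (D.pos e)) (segment ℝ (D.pos a) (D.pos b)) := by
    rintro e a b he ⟨hab, h1, h2⟩ hea heb
    obtain rfl | ⟨he, heT⟩ := he
    · exact hd1 a b (D.notMem _ _ _ hab hea heb)
    · by_cases ha : a = y
      · subst ha
        rw [Set.disjoint_left]
        intro z hz hz'
        have := hcone _ _ heT (h1 rfl) z hz hz'
        subst this
        exact D.notMem _ _ _ hab hea heb hz'
      by_cases hb : b = y
      · subst hb
        rw [segment_symm ℝ (D.pos a), Set.disjoint_left]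
        intro z hz hz'
        have := hcone _ _ heT (h2 rfl) z hz hz'
        subst this
        exact D.notMem _ _ _ hab.symm heb hea hz'
      · exact hε _ _ _ (D.disj _ _ _ _ he hab (Ne.symm ha) (Ne.symm hb) hea heb)
  refine ⟨⟨pos', hinj, ?_, ?_⟩⟩
  · rintro (_ | a) (_ | b) (_ | v) hab hva hvb
    · exact hab.elim
    · exact hab.elim
    · exact absurd rfl hva
    · exact hnm1 b v hab (by simpa using hvb)
    · exact absurd rfl hvb
    · change D.pos v ∉ segment ℝ (D.pos a) y'
      rw [segment_symm]; exact hnm1 a v hab (by simpa using hva)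
    · exact hnm2 a b hab
    · exact D.notMem a b v hab.1 (by simpa using hva) (by simpa using hvb)
  · rintro (_ | a) (_ | b) (_ | c) (_ | e) hab hce h1 h2 h3 h4
    · exact absurd rfl h1
    · exact absurd rfl h1
    · exact absurd rfl h2
    · exact hab.elim
    · exact absurd rfl h1
    · exact absurd rfl h1
    · exact absurd rfl h2
    · exact hdj b c e hab hce (by simpa using h3) (by simpa using h4)
    · exact absurd rfl h3
    · exact absurd rfl h3
    · exact absurd rfl h4
    · change Disjoint (segment ℝ (D.pos a) y') _
      rw [segment_symm]
      exact hdj a c e hab hce (by simpa using h1) (by simpa using h2)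
    · exact hce.elim
    · exact (hdj e a b hce hab (Ne.symm (by simpa using h2)) (Ne.symm (by simpa using h4))).symm
    · refine Disjoint.symm ?_
      change Disjoint (segment ℝ (D.pos c) y') _
      rw [segment_symm]
      exact hdj c a b hce hab (Ne.symm (by simpa using h1)) (Ne.symm (by simpa using h3))
    · exact D.disj a b c e hab.1 hce.1 (by simpa using h1) (by simpa using h2)
        (by simpa using h3) (by simpa using h4)

/-! ### Sectors between two neighbours of a vertex. -/

/-- The functional `z ↦ ‖z‖ sin (arg z - α)`. -/
noncomputable def sinForm (α : ℝ) : ℂ →ₗ[ℝ] ℝ where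
  toFun z := z.im * Real.cos α - z.re * Real.sin α
  map_add' z w := by simp; ring
  map_smul' c z := by simp; ring

theorem sinForm_apply (α : ℝ) (z : ℂ) : sinForm α z = ‖z‖ * Real.sin (z.arg - α) := by
  change z.im * Real.cos α - z.re * Real.sin α = _
  rw [Real.sin_sub]
  have h1 := Complex.norm_mul_cos_arg z
  have h2 := Complex.norm_mul_sin_arg z
  rw [← h1, ← h2]
  simp only [Complex.norm_mul_cos_arg, Complex.norm_mul_sin_arg]
  rw [mul_sub, ← mul_assoc, ← mul_assoc, h1, h2]

theorem sinForm_cos_sin (α φ : ℝ) :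
    sinForm α (⟨Real.cos φ, Real.sin φ⟩ : ℂ) = Real.sin (φ - α) := by
  change Real.sin φ * Real.cos α - Real.cos φ * Real.sin α = _
  rw [Real.sin_sub]

/-- Of two neighbours seen from `y` in the same direction, the nearer would lie on the edge to the
farther. -/
theorem StraightDrawing.arg_injOn {X : Type*} {K : SimpleGraph X} (D : StraightDrawing K) (y : X) :
    InjOn (fun z => (D.pos z - D.pos y).arg) (K.neighborSet y) := by
  have key : ∀ u v, K.Adj y u → K.Adj y v → (D.pos u - D.pos y).arg = (D.pos v - D.pos y).arg →
      ‖D.pos u - D.pos y‖ ≤ ‖D.pos v - D.pos y‖ → u = v := by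
    intro u v hu hv h hle
    by_contra huv
    refine D.notMem y v u hv hu.ne' huv ?_
    have hv0 : 0 < ‖D.pos v - D.pos y‖ := norm_pos_iff.2 (sub_ne_zero.2 (D.inj.ne hv.ne'))
    set t := ‖D.pos u - D.pos y‖ / ‖D.pos v - D.pos y‖ with ht
    have ht0 : 0 ≤ t := by positivity
    have ht1 : t ≤ 1 := (div_le_one hv0).2 hle
    refine ⟨1 - t, t, by linarith, ht0, by ring, ?_⟩
    have e1 : D.pos u - D.pos y = t • (D.pos v - D.pos y) := by
      rw [← Complex.norm_mul_exp_arg_mul_I (D.pos u - D.pos y),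
        ← Complex.norm_mul_exp_arg_mul_I (D.pos v - D.pos y), h, Complex.real_smul, ← mul_assoc]
      congr 1
      have : t * ‖D.pos v - D.pos y‖ = ‖D.pos u - D.pos y‖ := div_mul_cancel₀ _ hv0.ne'
      exact_mod_cast this.symm
    simp only [Complex.real_smul, Complex.ofReal_sub, Complex.ofReal_one] at e1 ⊢
    linear_combination -e1
  intro u hu v hv h
  rcases le_total ‖D.pos u - D.pos y‖ ‖D.pos v - D.pos y‖ with hle | hle
  · exact key u v hu hv h hle
  · exact (key v u hv hu h.symm hle).symm

/-- A sector of angle at most π is an intersection of two half-planes, with its bisector as inner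
direction. A wider sector is not convex but the opposite sector is, so there the two copies of `y`
exchange roles. -/
theorem StraightDrawing.split_of_lt {X : Type*} [Finite X] {K : SimpleGraph X}
    (D : StraightDrawing K) (y u v : X)
    (huv : (D.pos u - D.pos y).arg < (D.pos v - D.pos y).arg) :
    IsStraight (splitVertex K y
      {z | (D.pos z - D.pos y).arg ∉ Ioo (D.pos u - D.pos y).arg (D.pos v - D.pos y).arg}
      {z | (D.pos z - D.pos y).arg ∈ Icc (D.pos u - D.pos y).arg (D.pos v - D.pos y).arg}) := by
  set α := (D.pos u - D.pos y).arg
  set β := (D.pos v - D.pos y).arg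
  have ha1 : -Real.pi < α := Complex.neg_pi_lt_arg _
  have hb2 : β ≤ Real.pi := Complex.arg_le_pi _
  have hpi := Real.pi_pos
  have hsin : 0 < Real.sin ((β - α) / 2) := Real.sin_pos_of_pos_of_lt_pi (by linarith) (by linarith)
  rcases le_or_gt (β - α) Real.pi with hle | hgt
  · refine (IsStraight.splitVertex_of_cone D y (sinForm α) (-sinForm β)
      ⟨Real.cos ((α + β) / 2), Real.sin ((α + β) / 2)⟩ ?_ ?_).mono (splitVertex_mono ?_ ?_)
    · rw [sinForm_cos_sin]; convert hsin using 2; ring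
    · rw [LinearMap.neg_apply, sinForm_cos_sin, ← Real.sin_neg]; convert hsin using 2; ring
    · rintro z ⟨hz, -⟩ ⟨h1, h2⟩
      rw [sinForm_apply] at h1
      rw [LinearMap.neg_apply, sinForm_apply, ← mul_neg, ← Real.sin_neg] at h2
      replace h1 := pos_of_mul_pos_right h1 (norm_nonneg _)
      replace h2 := pos_of_mul_pos_right h2 (norm_nonneg _)
      set γ := (D.pos z - D.pos y).arg with hγ
      have hg1 : -Real.pi < γ := Complex.neg_pi_lt_arg _
      have hg2 : γ ≤ Real.pi := Complex.arg_le_pi _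
      -- Arguments are normalised to (-π, π], so positivity of a sine determines the angle only up
      -- to 2π. Outside the interval, one positive sine forces a difference below -π, and then the
      -- other sine is nonpositive.
      rcases le_or_gt γ α with h | h
      · have h3 : γ - α < -Real.pi := by
          by_contra h3
          exact absurd h1 (not_lt.2 (Real.sin_nonpos_of_nonpos_of_neg_pi_le
            (by linarith) (by linarith)))
        have : Real.sin (-(γ - β)) ≤ 0 := by
          rw [← Real.sin_sub_two_pi]
          exact Real.sin_nonpos_of_nonpos_of_neg_pi_le (by linarith) (by linarith)
        linarith
      · have h' : β ≤ γ := by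
          by_contra h'
          exact hz ⟨h, not_le.1 h'⟩
        have h3 : -(γ - β) < -Real.pi := by
          by_contra h3
          exact absurd h2 (not_lt.2 (Real.sin_nonpos_of_nonpos_of_neg_pi_le
            (by linarith) (by linarith)))
        have : Real.sin (γ - α) ≤ 0 := by
          rw [← Real.sin_sub_two_pi]
          exact Real.sin_nonpos_of_nonpos_of_neg_pi_le (by linarith) (by linarith)
        linarith
    · rintro z ⟨⟨h1, h2⟩, -⟩
      constructor
      · rw [sinForm_apply]
        exact mul_nonneg (norm_nonneg _)
          (Real.sin_nonneg_of_nonneg_of_le_pi (by linarith) (by linarith))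
      · rw [LinearMap.neg_apply, sinForm_apply, ← mul_neg, ← Real.sin_neg]
        exact mul_nonneg (norm_nonneg _)
          (Real.sin_nonneg_of_nonneg_of_le_pi (by linarith) (by linarith))
  · refine IsStraight.splitVertex_swap ?_
    refine (IsStraight.splitVertex_of_cone D y (sinForm β) (-sinForm α)
      (-⟨Real.cos ((α + β) / 2), Real.sin ((α + β) / 2)⟩) ?_ ?_).mono (splitVertex_mono ?_ ?_)
    · rw [map_neg, sinForm_cos_sin, ← Real.sin_neg]; convert hsin using 2; ring
    · rw [LinearMap.neg_apply, map_neg, neg_neg, sinForm_cos_sin]; convert hsin using 2; ring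
    · rintro z ⟨⟨hz1, hz2⟩, -⟩ ⟨h1, h2⟩
      rw [sinForm_apply] at h1
      rw [LinearMap.neg_apply, sinForm_apply, ← mul_neg, ← Real.sin_neg] at h2
      replace h1 := pos_of_mul_pos_right h1 (norm_nonneg _)
      replace h2 := pos_of_mul_pos_right h2 (norm_nonneg _)
      have h3 : (D.pos z - D.pos y).arg - β < -Real.pi := by
        by_contra h3
        exact absurd h1 (not_lt.2 (Real.sin_nonpos_of_nonpos_of_neg_pi_le
          (by linarith) (by linarith)))
      have h4 : -((D.pos z - D.pos y).arg - α) < -Real.pi := by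
        by_contra h3
        exact absurd h2 (not_lt.2 (Real.sin_nonpos_of_nonpos_of_neg_pi_le
          (by linarith) (by linarith)))
      linarith
    · rintro z ⟨hz, -⟩
      have hg1 : -Real.pi < (D.pos z - D.pos y).arg := Complex.neg_pi_lt_arg _
      have hg2 : (D.pos z - D.pos y).arg ≤ Real.pi := Complex.arg_le_pi _
      change _ ∉ _ at hz
      simp only [mem_ofPred_eq, LinearMap.neg_apply, sinForm_apply]
      set γ := (D.pos z - D.pos y).arg
      rw [← mul_neg, ← Real.sin_neg]
      suffices 0 ≤ Real.sin (γ - β) ∧ 0 ≤ Real.sin (-(γ - α)) from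
        ⟨mul_nonneg (norm_nonneg _) this.1, mul_nonneg (norm_nonneg _) this.2⟩
      rcases le_or_gt γ α with h | h
      · rw [← Real.sin_add_two_pi (γ - β)]
        exact ⟨Real.sin_nonneg_of_nonneg_of_le_pi (by linarith) (by linarith),
          Real.sin_nonneg_of_nonneg_of_le_pi (by linarith) (by linarith)⟩
      · have h' : β ≤ γ := by
          by_contra h'
          exact hz ⟨h, not_le.1 h'⟩
        rw [← Real.sin_add_two_pi (-(γ - α))]
        exact ⟨Real.sin_nonneg_of_nonneg_of_le_pi (by linarith) (by linarith),
          Real.sin_nonneg_of_nonneg_of_le_pi (by linarith) (by linarith)⟩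

/-- The neighbours of a vertex `y` of a straight-line drawing are ordered by their angle `θ`, and
`y` can be split along any two of them. -/
theorem IsStraight.exists_angle {X : Type*} [Finite X] {K : SimpleGraph X} (hK : IsStraight K)
    (y : X) : ∃ θ : X → ℝ, InjOn θ (K.neighborSet y) ∧
      ∀ u ∈ K.neighborSet y, ∀ v ∈ K.neighborSet y, u ≠ v →
        IsStraight (splitVertex K y {z | θ z ∉ uIoo (θ u) (θ v)} {z | θ z ∈ uIcc (θ u) (θ v)}) := by
  obtain ⟨D⟩ := hK
  refine ⟨fun z => (D.pos z - D.pos y).arg, D.arg_injOn y, fun u hu v hv huv => ?_⟩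
  rcases lt_or_gt_of_ne ((D.arg_injOn y).ne hu hv huv) with h | h
  · simp only [uIoo_of_lt h, uIcc_of_lt h]
    exact D.split_of_lt y u v h
  · simp only [uIoo_of_gt h, uIcc_of_gt h]
    exact D.split_of_lt y v u h

/-! ### Induced connectivity -/

/-- Connectivity as the absence of a proper part closed under adjacency. Branch sets are tested in
this form, without walks in subtypes. -/
theorem induce_connected_iff {X : Type*} {K : SimpleGraph X} {S : Set X} :
    (K.induce S).Connected ↔ S.Nonempty ∧ ∀ T : Set X, (S ∩ T).Nonempty →
      (∀ a ∈ S, a ∈ T → ∀ b ∈ S, K.Adj a b → b ∈ T) → S ⊆ T := by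
  constructor
  · intro h
    refine ⟨Set.nonempty_coe_sort.1 h.nonempty, ?_⟩
    rintro T ⟨a, haS, haT⟩ hcl b hbS
    obtain ⟨p⟩ := h.preconnected ⟨a, haS⟩ ⟨b, hbS⟩
    suffices ∀ x y : S, (K.induce S).Walk x y → (x : X) ∈ T → (y : X) ∈ T from this _ _ p haT
    intro x y p
    induction p with
    | nil => exact id
    | cons hadj _ ih => exact fun hx => ih (hcl _ (Subtype.coe_prop _) hx _ (Subtype.coe_prop _) hadj)
  · rintro ⟨⟨a, ha⟩, h⟩
    have key : ∀ b (hb : b ∈ S), (K.induce S).Reachable ⟨a, ha⟩ ⟨b, hb⟩ := by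
      intro b hb
      have h' : b ∈ {b | ∃ hb : b ∈ S, (K.induce S).Reachable ⟨a, ha⟩ ⟨b, hb⟩} := by
        refine h {b | ∃ hb : b ∈ S, (K.induce S).Reachable ⟨a, ha⟩ ⟨b, hb⟩}
          ⟨a, ha, ha, SimpleGraph.Reachable.refl _⟩ ?_ hb
        rintro x hx ⟨_, hx'⟩ y hy hxy
        exact ⟨hy, hx'.trans (SimpleGraph.Adj.reachable (G := K.induce S) (u := ⟨x, hx⟩)
          (v := ⟨y, hy⟩) hxy)⟩
      exact h'.2
    have : Nonempty S := ⟨⟨a, ha⟩⟩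
    exact ⟨fun x y => (key x x.2).symm.trans (key y y.2)⟩

theorem induce_connected_image {X Y : Type*} {K : SimpleGraph X} {K' : SimpleGraph Y} {S : Set X}
    (hS : (K.induce S).Connected) (f : X → Y)
    (hf : ∀ a ∈ S, ∀ b ∈ S, K.Adj a b → K'.Adj (f a) (f b)) :
    (K'.induce (f '' S)).Connected := by
  rw [induce_connected_iff] at hS ⊢
  refine ⟨hS.1.image f, ?_⟩
  rintro T ⟨_, ⟨a, haS, rfl⟩, haT⟩ hcl
  have := hS.2 (f ⁻¹' T) ⟨a, haS, haT⟩ fun x hx hxT y hy hxy =>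
    hcl _ (mem_image_of_mem f hx) hxT _ (mem_image_of_mem f hy) (hf x hx y hy hxy)
  rintro _ ⟨b, hb, rfl⟩
  exact this hb

theorem induce_connected_singleton {X : Type*} {K : SimpleGraph X} {a : X} :
    (K.induce {a}).Connected := by
  rw [induce_connected_iff]
  refine ⟨singleton_nonempty a, ?_⟩
  rintro T ⟨_, rfl, h⟩ _ _ rfl
  exact h

theorem exists_adj_of_induce_connected {X : Type*} {K : SimpleGraph X} {S : Set X}
    (hS : (K.induce S).Connected) {q b : X} (hq : q ∈ S) (hb : b ∈ S) (hqb : b ≠ q) :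
    ∃ p ∈ S, K.Adj q p := by
  by_contra! h
  refine hqb ((induce_connected_iff.1 hS).2 {q} ⟨q, hq, rfl⟩ ?_ hb)
  rintro a ha rfl c hc hac
  exact absurd hac (h c hc)

/-- A non-cut vertex, which a core can give up. -/
theorem exists_induce_diff_singleton_connected {X : Type*} [Finite X] {K : SimpleGraph X}
    {S : Set X} (hS : (K.induce S).Connected) (hnt : S.Nontrivial) :
    ∃ q ∈ S, (K.induce (S \ {q})).Connected := by
  have : Nontrivial S := hnt.coe_sort
  obtain ⟨q, hq⟩ := hS.exists_connected_induce_compl_singleton_of_finite_nontrivial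
  refine ⟨q, q.2, ?_⟩
  have : (Subtype.val : S → X) '' {q}ᶜ = S \ {(q : X)} := by
    ext x
    simp only [mem_image, mem_compl_iff, mem_singleton_iff, Set.mem_sdiff]
    constructor
    · rintro ⟨a, ha, rfl⟩
      exact ⟨a.2, fun h => ha (Subtype.ext h)⟩
    · rintro ⟨hx, hne⟩
      exact ⟨⟨x, hx⟩, fun h => hne (congrArg Subtype.val h), rfl⟩
  rw [← this]
  exact induce_connected_image hq _ fun a _ b _ hab => hab

/-! ### Reducing branch sets to subdivided stars -/

/-- The vertex `q` gives up its neighbour `v`; a new vertex `none` is joined to `p` and `v`. -/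
def splitOff {X : Type*} (K : SimpleGraph X) (q p v : X) : SimpleGraph (Option X) where
  Adj
    | some a, some b => K.Adj a b ∧ ¬ (a = q ∧ b = v) ∧ ¬ (a = v ∧ b = q)
    | some a, none => a = p ∨ a = v
    | none, some a => a = p ∨ a = v
    | none, none => False
  symm := ⟨by
    rintro (_ | a) (_ | b) h
    · exact h
    · exact h
    · exact h
    · exact ⟨h.1.symm, fun e => h.2.2 e.symm, fun e => h.2.1 e.symm⟩⟩
  loopless := ⟨by
    rintro (_ | a) h
    · exact h
    · exact h.1.ne rfl⟩

theorem abs_sub_lt_of_mem_uIoo {a b x : ℝ} (h : x ∈ uIoo a b) : |x - a| < |b - a| := by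
  rcases le_total a b with hab | hab
  · rw [uIoo_of_le hab] at h
    rw [abs_of_pos (by linarith [h.1]), abs_of_nonneg (by linarith)]
    linarith [h.2]
  · rw [uIoo_of_ge hab] at h
    rw [abs_of_neg (by linarith [h.2]), abs_of_nonpos (by linarith)]
    linarith [h.1]

/-- Take for `v` the neighbour whose angle is closest to that of `p`. No neighbour lies strictly
between them, so when `q` is split along `p` and `v` the old copy can keep every neighbour. Deleting
the edge from it to `v` and the edge between the copies leaves `splitOff`. -/
theorem IsStraight.exists_splitOff {X : Type*} [Finite X] {K : SimpleGraph X} (hK : IsStraight K)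
    {q p : X} (hp : K.Adj q p) (hdeg : 1 < (K.neighborSet q).ncard) :
    ∃ v, K.Adj q v ∧ v ≠ p ∧ IsStraight (splitOff K q p v) := by
  obtain ⟨θ, -, hs⟩ := hK.exists_angle q
  have hne : (K.neighborSet q \ {p}).Nonempty := by
    rw [nonempty_iff_ne_empty]
    intro h
    have := ncard_le_ncard (sdiff_eq_empty.1 h)
    rw [ncard_singleton] at this
    omega
  obtain ⟨v, ⟨hv, hvp⟩, hmin⟩ :=
    exists_min_image _ (fun z => |θ z - θ p|) (toFinite (K.neighborSet q \ {p})) hne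
  refine ⟨v, hv, hvp, (hs p hp v hv (Ne.symm hvp)).mono ?_⟩
  have key : ∀ b, K.Adj q b → b ≠ v → θ b ∉ uIoo (θ p) (θ v) := by
    intro b hb hbv hmem
    have := abs_sub_lt_of_mem_uIoo hmem
    by_cases hbp : b = p
    · subst hbp
      rcases le_total (θ b) (θ v) with h | h
      · rw [uIoo_of_le h] at hmem; exact lt_irrefl _ hmem.1
      · rw [uIoo_of_ge h] at hmem; exact lt_irrefl _ hmem.2
    · exact absurd this (not_lt.2 (hmin b ⟨hb, hbp⟩))
  have key2 : ∀ a, a = p ∨ a = v → a = q ∨ (K.Adj q a ∧ θ a ∈ uIcc (θ p) (θ v)) := by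
    rintro a (rfl | rfl)
    · exact Or.inr ⟨hp, left_mem_uIcc⟩
    · exact Or.inr ⟨hv, right_mem_uIcc⟩
  rintro (_ | a) (_ | b) h
  · exact h
  · exact key2 b h
  · exact key2 a h
  · refine ⟨h.1, ?_, ?_⟩
    · rintro rfl
      exact key b h.1 fun e => h.2.1 ⟨rfl, e⟩
    · rintro rfl
      exact key a h.1.symm fun e => h.2.2 ⟨e, rfl⟩

/-- Branch sets `B v` of a minor `G` of `K`, with connected subsets `A v ⊆ B v`. -/
structure CoreModel {V X : Type*} (G : SimpleGraph V) (K : SimpleGraph X) (A B : V → Set X) :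
    Prop where
  core : ∀ v, (K.induce (A v)).Connected
  sub : ∀ v, A v ⊆ B v
  conn : ∀ v, (K.induce (B v)).Connected
  disj : ∀ u v, u ≠ v → Disjoint (B u) (B v)
  adj : ∀ u v, G.Adj u v → ∃ x ∈ B u, ∃ y ∈ B v, K.Adj x y

theorem CoreModel.eq_of_mem {V X : Type*} {G : SimpleGraph V} {K : SimpleGraph X} {A B : V → Set X}
    (h : CoreModel G K A B) {u v : V} {x : X} (hu : x ∈ B u) (hv : x ∈ B v) : u = v := by
  by_contra huv
  exact Set.disjoint_left.1 (h.disj u v huv) hu hv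

/-- `G` is a minor of a finite straight-line graph, with cores of total size at most `n` and all
other vertices in the branch sets of degree at most two. -/
def HasCoreModel {V : Type*} (G : SimpleGraph V) (n : ℕ) : Prop :=
  ∃ (X : Type) (_ : Finite X) (K : SimpleGraph X) (A B : V → Set X), IsStraight K ∧
    CoreModel G K A B ∧ (∀ v q, q ∈ B v → q ∉ A v → (K.neighborSet q).ncard ≤ 2) ∧
    (⋃ v, A v).ncard ≤ n

/-- The new vertex enters the branch set of `q`. If `v` lies in the same branch set, the lost edge
from `q` to `v` is replaced by the path through `p` and the new vertex; otherwise the edge from the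
new vertex to `v` does its work. No core contains `q`, so the cores are unaffected. -/
theorem CoreModel.splitOff {V X : Type*} {G : SimpleGraph V} {K : SimpleGraph X}
    {A B : V → Set X} (h : CoreModel G K A B) {u : V} {q p v : X} (hqB : q ∈ B u) (hqA : q ∉ A u)
    (hpA : p ∈ A u) (hqp : K.Adj q p) (hvp : v ≠ p) :
    CoreModel G (splitOff K q p v) (fun w => some '' A w)
      (fun w => some '' B w ∪ {x | x = none ∧ w = u}) := by
  have hkeep : ∀ S : Set X, q ∉ S → ∀ a ∈ S, ∀ b ∈ S, K.Adj a b →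
      (PlanarMinor.splitOff K q p v).Adj (some a) (some b) := by
    rintro S hq a ha b hb hab
    exact ⟨hab, fun e => hq (e.1 ▸ ha), fun e => hq (e.2 ▸ hb)⟩
  have hqA' : ∀ w, q ∉ A w := by
    intro w hw
    obtain rfl := h.eq_of_mem hqB (h.sub w hw)
    exact hqA hw
  have hpq : (PlanarMinor.splitOff K q p v).Adj (some p) (some q) :=
    ⟨hqp.symm, fun e => hqp.ne e.1.symm, fun e => hvp e.1.symm⟩
  refine ⟨fun w => induce_connected_image (h.core w) _ (hkeep _ (hqA' w)),
    fun w => (image_mono (h.sub w)).trans subset_union_left, ?_, ?_, ?_⟩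
  · intro w
    by_cases hw : w = u
    · subst hw
      have hB := h.conn w
      rw [induce_connected_iff] at hB ⊢
      refine ⟨⟨none, Or.inr ⟨rfl, rfl⟩⟩, fun T hT hcl => ?_⟩
      have hs : ∀ {a}, a ∈ B w → some a ∈ some '' B w ∪ {x | x = none ∧ w = w} := fun ha =>
        Or.inl (mem_image_of_mem _ ha)
      have hn : none ∈ some '' B w ∪ {x : Option X | x = none ∧ w = w} := Or.inr ⟨rfl, rfl⟩
      have hpB := h.sub w hpA
      have hnp : none ∈ T → some p ∈ T := fun hT => hcl _ hn hT _ (hs hpB) (Or.inl rfl)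
      have hpn : some p ∈ T → none ∈ T := fun hT => hcl _ (hs hpB) hT _ hn (Or.inl rfl)
      have hT1 : (B w ∩ {a | some a ∈ T}).Nonempty := by
        obtain ⟨_, ⟨a, ha, rfl⟩ | ⟨rfl, -⟩, haT⟩ := hT
        · exact ⟨a, ha, haT⟩
        · exact ⟨p, hpB, hnp haT⟩
      have hall := hB.2 {a | some a ∈ T} hT1 (by
        intro a ha haT b hb hab
        by_cases h1 : a = q ∧ b = v
        · obtain ⟨rfl, rfl⟩ := h1
          exact hcl _ hn (hpn (hcl _ (hs ha) haT _ (hs hpB) hpq.symm)) _ (hs hb) (Or.inr rfl)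
        by_cases h2 : a = v ∧ b = q
        · obtain ⟨rfl, rfl⟩ := h2
          exact hcl _ (hs hpB) (hnp (hcl _ (hs ha) haT _ hn (Or.inr rfl))) _ (hs hb) hpq
        · exact hcl _ (hs ha) haT _ (hs hb) ⟨hab, h1, h2⟩)
      rintro _ (⟨a, ha, rfl⟩ | ⟨rfl, -⟩)
      · exact hall ha
      · exact hpn (hall hpB)
    · have : some '' B w ∪ {x : Option X | x = none ∧ w = u} = some '' B w := by
        ext x; simp [hw]
      rw [this]
      refine induce_connected_image (h.conn w) _ (hkeep _ fun hq => hw (h.eq_of_mem hq hqB))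
  · intro w w' hww
    rw [Set.disjoint_left]
    rintro _ (⟨a, ha, rfl⟩ | ⟨rfl, rfl⟩) (⟨b, hb, e⟩ | ⟨e, rfl⟩)
    · rw [Option.some_inj] at e
      subst e
      exact hww (h.eq_of_mem ha hb)
    · simp at e
    · simp at e
    · exact hww rfl
  · intro w w' hww
    obtain ⟨x, hx, z, hz, hxz⟩ := h.adj w w' hww
    by_cases h1 : x = q ∧ z = v
    · obtain ⟨rfl, rfl⟩ := h1
      exact ⟨none, Or.inr ⟨rfl, h.eq_of_mem hx hqB⟩, some z, Or.inl (mem_image_of_mem _ hz),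
        Or.inr rfl⟩
    by_cases h2 : x = v ∧ z = q
    · obtain ⟨rfl, rfl⟩ := h2
      exact ⟨some x, Or.inl (mem_image_of_mem _ hx), none, Or.inr ⟨rfl, h.eq_of_mem hz hqB⟩,
        Or.inr rfl⟩
    · exact ⟨some x, Or.inl (mem_image_of_mem _ hx), some z, Or.inl (mem_image_of_mem _ hz),
        hxz, h1, h2⟩

/-- The vertex `q` loses `v`, and `v` sees the new vertex in place of `q`. Only `p` gains a
neighbour, which is harmless when `p` lies in a core, where degrees are not bounded. -/
theorem ncard_neighborSet_splitOff_le {X : Type*} [Finite X] {K : SimpleGraph X} {q p v : X}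
    (hqv : K.Adj q v) {z : X} (hzp : z ≠ p) :
    ((splitOff K q p v).neighborSet (some z)).ncard ≤ (K.neighborSet z).ncard := by
  refine ncard_le_ncard_of_injOn (fun o => o.getD q) ?_ ?_ (toFinite _)
  · rintro (_ | a) ha
    · obtain rfl | rfl := (ha : z = p ∨ z = v)
      · exact absurd rfl hzp
      · exact hqv.symm
    · exact ha.1
  · rintro (_ | a) ha (_ | b) hb hab
    · rfl
    · obtain rfl | rfl := (ha : z = p ∨ z = v)
      · exact absurd rfl hzp
      · exact absurd ⟨rfl, Eq.symm hab⟩ hb.2.2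
    · obtain rfl | rfl := (hb : z = p ∨ z = v)
      · exact absurd rfl hzp
      · exact absurd ⟨rfl, hab⟩ ha.2.2
    · exact congrArg some hab

/-- This repairs a model after `q` has left its core. Each `splitOff` lowers the degree of `q` by
one and creates a vertex of degree at most two, while the total size of the cores stays the same;
the induction is on the excess degree of `q`. -/
theorem hasCoreModel_of_degree_le {V : Type*} {G : SimpleGraph V} (m : ℕ) :
    ∀ (X : Type) [Finite X] (K : SimpleGraph X) (A B : V → Set X) (u : V) (q p : X),
      IsStraight K → CoreModel G K A B → q ∈ B u → q ∉ A u → p ∈ A u → K.Adj q p →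
      (K.neighborSet q).ncard ≤ m + 2 →
      (∀ v z, z ≠ q → z ∈ B v → z ∉ A v → (K.neighborSet z).ncard ≤ 2) →
      HasCoreModel G (⋃ v, A v).ncard := by
  induction m with
  | zero =>
    intro X _ K A B u q p hK hM hqB hqA hpA hqp hdq hdeg
    refine ⟨X, inferInstance, K, A, B, hK, hM, fun v z hz hz' => ?_, le_rfl⟩
    by_cases hzq : z = q
    · subst hzq; exact hdq
    · exact hdeg v z hzq hz hz'
  | succ m ih =>
    intro X _ K A B u q p hK hM hqB hqA hpA hqp hdq hdeg
    by_cases hlt : (K.neighborSet q).ncard ≤ m + 2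
    · exact ih X K A B u q p hK hM hqB hqA hpA hqp hlt hdeg
    obtain ⟨v, hqv, hvp, hstr⟩ := hK.exists_splitOff hqp (by omega)
    have hM' := hM.splitOff hqB hqA hpA hqp hvp
    have hcard : (⋃ w, (some '' A w : Set (Option X))).ncard = (⋃ w, A w).ncard := by
      rw [← image_iUnion, ncard_image_of_injective _ (Option.some_injective _)]
    rw [← hcard]
    refine ih (Option X) _ _ _ u (some q) (some p) hstr hM' (Or.inl (mem_image_of_mem _ hqB)) ?_
      (mem_image_of_mem _ hpA) ?_ ?_ ?_
    · rintro ⟨a, ha, e⟩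
      rw [Option.some_inj] at e
      exact hqA (e ▸ ha)
    · exact ⟨hqp, fun e => hvp e.2.symm, fun e => hqp.ne e.2.symm⟩
    · have hsub : (splitOff K q p v).neighborSet (some q) ⊆ some '' (K.neighborSet q \ {v}) := by
        rintro (_ | a) ha
        · obtain h | h := (ha : q = p ∨ q = v)
          · exact absurd h hqp.ne
          · exact absurd h hqv.ne
        · exact ⟨a, ⟨ha.1, fun e => ha.2.1 ⟨rfl, e⟩⟩, rfl⟩
      have h1 := ncard_le_ncard hsub
      rw [ncard_image_of_injective _ (Option.some_injective _),
        ncard_sdiff_singleton_of_mem (show v ∈ K.neighborSet q from hqv)] at h1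
      omega
    · rintro w (_ | z) hzq hzB hzA
      · have hsub : (splitOff K q p v).neighborSet none ⊆ {some p, some v} := by
          rintro (_ | a) ha
          · exact ha.elim
          · obtain rfl | rfl := (ha : a = p ∨ a = v)
            · exact Or.inl rfl
            · exact Or.inr rfl
        exact (ncard_le_ncard hsub).trans
          ((ncard_insert_le _ _).trans (by rw [ncard_singleton]))
      · have hzB' : z ∈ B w := by simpa using hzB
        have hzA' : z ∉ A w := fun h => hzA (mem_image_of_mem _ h)
        refine (ncard_neighborSet_splitOff_le hqv ?_).trans
          (hdeg w z (fun e => hzq (congrArg some e)) hzB' hzA')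
        rintro rfl
        obtain rfl := hM.eq_of_mem hzB' (hM.sub u hpA)
        exact hzA' hpA

open Classical in
/-- A minor of a finite straight-line graph is modelled by subdivided stars in some finite
straight-line graph. -/
theorem exists_star_model {V : Type*} {G : SimpleGraph V} {n : ℕ} (h : HasCoreModel G n) :
    ∃ (X : Type) (_ : Finite X) (K : SimpleGraph X) (c : V → X) (B : V → Set X), IsStraight K ∧
      CoreModel G K (fun v => {c v}) B ∧
      ∀ v q, q ∈ B v → q ≠ c v → (K.neighborSet q).ncard ≤ 2 := by
  have hex : ∃ n, HasCoreModel G n := ⟨n, h⟩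
  obtain ⟨X, _, K, A, B, hK, hM, hdeg, hn⟩ := Nat.find_spec hex
  have hmin : ∀ m, m < (⋃ v, A v).ncard → ¬ HasCoreModel G m := fun m hm =>
    Nat.find_min hex (hm.trans_le hn)
  -- In a model of least total core size, a core with two vertices could drop a non-cut vertex `q`.
  -- Once its degree is reduced to two, this contradicts minimality.
  have hsub : ∀ u, (A u).Subsingleton := by
    intro u
    by_contra hnt
    rw [Set.not_subsingleton_iff] at hnt
    obtain ⟨q, hq, hconn⟩ := exists_induce_diff_singleton_connected (hM.core u) hnt
    obtain ⟨b, hb, hbq⟩ := hnt.exists_ne q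
    obtain ⟨p, hp, hqp⟩ := exists_adj_of_induce_connected (hM.core u) hq hb hbq
    set A' : V → Set X := Function.update A u (A u \ {q}) with hA'
    have hA'u : A' u = A u \ {q} := Function.update_self _ _ _
    have hA'w : ∀ w, w ≠ u → A' w = A w := fun w hw => Function.update_of_ne hw _ _
    have hA'sub : ∀ w, A' w ⊆ A w := by
      intro w
      by_cases hw : w = u
      · subst hw; rw [hA'u]; exact sdiff_subset
      · rw [hA'w w hw]
    have hqA' : ∀ w, q ∉ A' w := by
      intro w hw
      obtain rfl := hM.eq_of_mem (hM.sub u hq) (hM.sub w (hA'sub w hw))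
      rw [hA'u] at hw
      exact hw.2 rfl
    refine hmin (⋃ v, A' v).ncard (ncard_lt_ncard ⟨iUnion_mono hA'sub, fun h => ?_⟩)
      (hasCoreModel_of_degree_le _ X K A' B u q p hK ⟨?_, ?_, hM.conn, hM.disj, hM.adj⟩
        (hM.sub u hq) (hqA' u) ?_ hqp (Nat.le_add_right _ 2) ?_)
    · obtain ⟨w, hw⟩ := mem_iUnion.1 (h (mem_iUnion.2 ⟨u, hq⟩))
      exact hqA' w hw
    · intro w
      by_cases hw : w = u
      · subst hw; rw [hA'u]; exact hconn
      · rw [hA'w w hw]; exact hM.core w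
    · exact fun w => (hA'sub w).trans (hM.sub w)
    · rw [hA'u]; exact ⟨hp, hqp.ne'⟩
    · intro w z hzq hzB hzA
      refine hdeg w z hzB fun hz => hzA ?_
      by_cases hw : w = u
      · subst hw; rw [hA'u]; exact ⟨hz, hzq⟩
      · rw [hA'w w hw]; exact hz
  have hne : ∀ v, (A v).Nonempty := fun v => Set.nonempty_coe_sort.1 (hM.core v).nonempty
  choose c hc using hne
  have hAc : A = fun v => {c v} := by
    funext v
    exact (hsub v).eq_singleton_of_mem (hc v)
  subst hAc
  exact ⟨X, inferInstance, K, c, B, hK, hM, hdeg⟩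

/-! ### Drawing paths of a straight-line graph as polygonal arcs. -/

/-- The standard identification of the complex plane with the Euclidean plane. -/
noncomputable def toPlane : ℂ ≃ₗ[ℝ] Plane := Complex.orthonormalBasisOneI.repr.toLinearEquiv

theorem toPlane_image_segment (a b : ℂ) :
    toPlane '' segment ℝ a b = segment ℝ (toPlane a) (toPlane b) :=
  image_segment ℝ toPlane.toLinearMap.toAffineMap a b

/-- A second common point would put `a` and `b` on one ray from `e`, and the nearer of them would
lie on the segment to the farther. -/
theorem segment_inter_segment_eq {E : Type*} [AddCommGroup E] [Module ℝ E] {a e b : E}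
    (h1 : b ∉ segment ℝ a e) (h2 : a ∉ segment ℝ e b) :
    segment ℝ a e ∩ segment ℝ e b = {e} := by
  refine Subset.antisymm ?_ (singleton_subset_iff.2
    ⟨right_mem_segment _ _ _, left_mem_segment _ _ _⟩)
  rintro z ⟨⟨s, t, hs, ht, hst, rfl⟩, ⟨s', t', hs', ht', hst', hz⟩⟩
  obtain rfl : t = 1 - s := by linarith
  obtain rfl : s' = 1 - t' := by linarith
  have key : t' • (b - e) = s • (a - e) := by
    have : t' • (b - e) - s • (a - e) =
        ((1 - t') • e + t' • b) - (s • a + (1 - s) • e) := by module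
    rw [← sub_eq_zero, this, hz, sub_self]
  rcases hs.eq_or_lt with rfl | hs
  · simp
  rcases ht'.eq_or_lt with rfl | ht'
  · simp only [zero_smul, sub_zero, one_smul, add_zero] at hz
    exact hz.symm
  exfalso
  rcases le_total t' s with hle | hle
  · refine h2 ⟨1 - t' / s, t' / s, sub_nonneg.2 ((div_le_one hs).2 hle), by positivity,
      by ring, ?_⟩
    have : a - e = (t' / s) • (b - e) := by
      rw [div_eq_inv_mul, mul_smul, key, smul_smul, inv_mul_cancel₀ hs.ne', one_smul]
    calc (1 - t' / s) • e + (t' / s) • b = e + (t' / s) • (b - e) := by module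
      _ = a := by rw [← this]; abel
  · refine h1 ⟨s / t', 1 - s / t', by positivity, sub_nonneg.2 ((div_le_one ht').2 hle),
      by ring, ?_⟩
    have : b - e = (s / t') • (a - e) := by
      rw [div_eq_inv_mul, mul_smul, ← key, smul_smul, inv_mul_cancel₀ ht'.ne', one_smul]
    calc (s / t') • a + (1 - s / t') • e = e + (s / t') • (a - e) := by module
      _ = b := by rw [← this]; abel

namespace StraightDrawing

variable {X : Type*} {K : SimpleGraph X} (D : StraightDrawing K)

/-- The drawing as a map to the Euclidean plane. -/
noncomputable def point (x : X) : Plane := toPlane (D.pos x)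

theorem point_injective : Function.Injective D.point := toPlane.injective.comp D.inj

theorem point_notMem {a b v : X} (h : K.Adj a b) (ha : v ≠ a) (hb : v ≠ b) :
    D.point v ∉ segment ℝ (D.point a) (D.point b) := by
  rw [point, point, point, ← toPlane_image_segment, toPlane.injective.mem_set_image]
  exact D.notMem a b v h ha hb

theorem point_disj {a b c d : X} (h : K.Adj a b) (h' : K.Adj c d) (h1 : a ≠ c) (h2 : a ≠ d)
    (h3 : b ≠ c) (h4 : b ≠ d) :
    Disjoint (segment ℝ (D.point a) (D.point b)) (segment ℝ (D.point c) (D.point d)) := by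
  simp only [point]
  rw [← toPlane_image_segment, ← toPlane_image_segment]
  exact (disjoint_image_iff toPlane.injective).2 (D.disj a b c d h h' h1 h2 h3 h4)

theorem point_inter {a e b : X} (h : K.Adj a e) (h' : K.Adj e b) (hab : a ≠ b) :
    segment ℝ (D.point a) (D.point e) ∩ segment ℝ (D.point e) (D.point b) = {D.point e} :=
  segment_inter_segment_eq (D.point_notMem h hab.symm h'.ne') (D.point_notMem h' h.ne hab)

theorem eq_or_exists_of_mem {a b c d : X} (h : K.Adj a b) (h' : K.Adj c d) {z : Plane}
    (hz : z ∈ segment ℝ (D.point a) (D.point b)) (hz' : z ∈ segment ℝ (D.point c) (D.point d)) :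
    s(a, b) = s(c, d) ∨ ∃ q, (q = a ∨ q = b) ∧ (q = c ∨ q = d) ∧ z = D.point q := by
  by_cases hac : a = c
  · subst hac
    by_cases hbd : b = d
    · subst hbd; exact Or.inl rfl
    · refine Or.inr ⟨a, Or.inl rfl, Or.inl rfl, ?_⟩
      rw [← mem_singleton_iff, ← D.point_inter h.symm h' hbd]
      exact ⟨segment_symm ℝ (D.point a) _ ▸ hz, hz'⟩
  by_cases had : a = d
  · subst had
    by_cases hbc : b = c
    · subst hbc; exact Or.inl Sym2.eq_swap
    · refine Or.inr ⟨a, Or.inl rfl, Or.inr rfl, ?_⟩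
      rw [← mem_singleton_iff, ← D.point_inter h.symm h'.symm hbc]
      exact ⟨segment_symm ℝ (D.point a) _ ▸ hz, segment_symm ℝ (D.point c) _ ▸ hz'⟩
  by_cases hbc : b = c
  · subst hbc
    refine Or.inr ⟨b, Or.inr rfl, Or.inl rfl, ?_⟩
    rw [← mem_singleton_iff, ← D.point_inter h h' had]
    exact ⟨hz, hz'⟩
  by_cases hbd : b = d
  · subst hbd
    refine Or.inr ⟨b, Or.inr rfl, Or.inr rfl, ?_⟩
    rw [← mem_singleton_iff, ← D.point_inter h h'.symm hac]
    exact ⟨hz, segment_symm ℝ (D.point c) _ ▸ hz'⟩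
  exact absurd hz' (Set.disjoint_left.1 (D.point_disj h h' hac had hbc hbd) hz)

/-- A path of the graph drawn as a polygonal arc. -/
noncomputable def arcOfPath {a b : X} (p : K.Walk a b) (hp : p.IsPath) (hab : a ≠ b) : PolyArc where
  len := p.length
  len_pos := Nat.pos_of_ne_zero fun h => hab (SimpleGraph.Walk.eq_of_length_eq_zero h)
  pt i := D.point (p.getVert i)
  nondegenerate i hi := D.point_injective.ne (p.adj_getVert_succ hi).ne
  consecutive i hi := by
    refine D.point_inter (p.adj_getVert_succ (by omega)) (p.adj_getVert_succ hi) fun h => ?_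
    have := hp.getVert_injOn (show i ≤ p.length by omega) (show i + 2 ≤ p.length by omega) h
    omega
  nonconsecutive i j hij hj := by
    have hne : ∀ k l, k < l → l ≤ p.length → p.getVert k ≠ p.getVert l := by
      intro k l hkl hl h
      have := hp.getVert_injOn (show k ≤ p.length by omega) (show l ≤ p.length by omega) h
      omega
    exact D.point_disj (p.adj_getVert_succ (by omega)) (p.adj_getVert_succ hj)
      (hne _ _ (by omega) (by omega)) (hne _ _ (by omega) (by omega))
      (hne _ _ (by omega) (by omega)) (hne _ _ (by omega) (by omega))

theorem mem_trace_arcOfPath {a b : X} {p : K.Walk a b} {hp : p.IsPath} {hab : a ≠ b} {z : Plane}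
    (hz : z ∈ (D.arcOfPath p hp hab).trace) :
    ∃ c ∈ p.support, ∃ d ∈ p.support, K.Adj c d ∧ z ∈ segment ℝ (D.point c) (D.point d) := by
  simp only [PolyArc.trace, mem_iUnion] at hz
  obtain ⟨i, hi, hz⟩ := hz
  exact ⟨p.getVert i, p.getVert_mem_support i, p.getVert (i + 1), p.getVert_mem_support _,
    p.adj_getVert_succ hi, hz⟩

end StraightDrawing

theorem CoreModel.exists_path {V X : Type*} {G : SimpleGraph V} {K : SimpleGraph X}
    {c : V → X} {B : V → Set X} (h : CoreModel G K (fun v => {c v}) B) {u v : V}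
    (huv : G.Adj u v) :
    ∃ p : K.Walk (c u) (c v), p.IsPath ∧ ∀ z ∈ p.support, z ∈ B u ∪ B v := by
  obtain ⟨x, hx, y, hy, hxy⟩ := h.adj u v huv
  have hconn : (K.induce (B u ∪ B v)).Connected := by
    have h1 := (induce_connected_iff.1 (h.conn u)).2
    have h2 := (induce_connected_iff.1 (h.conn v)).2
    refine induce_connected_iff.2 ⟨⟨x, Or.inl hx⟩, fun T hT hcl => ?_⟩
    have h1' : (B u ∩ T).Nonempty → B u ⊆ T := fun hne => h1 T hne
      fun a ha haT b hb hab => hcl a (Or.inl ha) haT b (Or.inl hb) hab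
    have h2' : (B v ∩ T).Nonempty → B v ⊆ T := fun hne => h2 T hne
      fun a ha haT b hb hab => hcl a (Or.inr ha) haT b (Or.inr hb) hab
    obtain ⟨a, ha | ha, haT⟩ := hT
    · have h3 := h1' ⟨a, ha, haT⟩
      exact union_subset h3 (h2' ⟨y, hy, hcl x (Or.inl hx) (h3 hx) y (Or.inr hy) hxy⟩)
    · have h3 := h2' ⟨a, ha, haT⟩
      exact union_subset (h1' ⟨x, hx, hcl y (Or.inr hy) (h3 hy) x (Or.inl hx) hxy.symm⟩) h3
  have hu : c u ∈ B u ∪ B v := Or.inl (h.sub u rfl)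
  have hv : c v ∈ B u ∪ B v := Or.inr (h.sub v rfl)
  obtain ⟨p, hp⟩ := hconn.exists_isPath ⟨c u, hu⟩ ⟨c v, hv⟩
  let f : K.induce (B u ∪ B v) →g K := ⟨Subtype.val, id⟩
  refine ⟨p.map f, hp.map (f := f) Subtype.val_injective, fun z hz => ?_⟩
  have hz' : z ∈ p.support.map f := by
    rw [← SimpleGraph.Walk.support_map]
    exact hz
  obtain ⟨w, -, rfl⟩ := List.mem_map.1 hz'
  exact w.2

/-- Each edge is drawn along a path between two centres inside the union of their branch sets. A
vertex of a branch set other than its centre has degree at most two, so a path passing through it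
uses all its edges. Two paths that share such a vertex therefore join the same centres, and paths of
distinct edges meet in centres only. -/
theorem isPlanar_of_star_model {V X : Type*} [Finite X] {G : SimpleGraph V} {K : SimpleGraph X}
    {c : V → X} {B : V → Set X} (hK : IsStraight K) (h : CoreModel G K (fun v => {c v}) B)
    (hdeg : ∀ v q, q ∈ B v → q ≠ c v → (K.neighborSet q).ncard ≤ 2) : IsPlanar G := by
  obtain ⟨D⟩ := hK
  have hcB : ∀ v, c v ∈ B v := fun v => h.sub v rfl
  have hcinj : Function.Injective c := fun u v huv => h.eq_of_mem (hcB u) (huv ▸ hcB v)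
  have hex : ∀ e : G.edgeSet, ∃ (u v : V) (p : K.Walk (c u) (c v)), (e : Sym2 V) = s(u, v) ∧
      p.IsPath ∧ ∀ z ∈ p.support, z ∈ B u ∪ B v := by
    rintro ⟨⟨u, v⟩, huv⟩
    obtain ⟨p, hp⟩ := h.exists_path huv
    exact ⟨u, v, p, rfl, hp⟩
  choose u v p he hp hsup using hex
  have huv : ∀ e, u e ≠ v e := by
    intro e
    have := e.2
    rw [he e] at this
    exact (SimpleGraph.mem_edgeSet _ |>.1 this).ne
  have hcuv : ∀ e, c (u e) ≠ c (v e) := fun e => hcinj.ne (huv e)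
  have hmemB : ∀ e q w, q ∈ (p e).support → q ∈ B w → w ∈ (e : Sym2 V) := by
    intro e q w hq hw
    rw [he e, Sym2.mem_iff]
    exact (hsup e q hq).imp (fun h' => h.eq_of_mem hw h') (fun h' => h.eq_of_mem hw h')
  have hends : ∀ e w i, i ≤ (p e).length → (p e).getVert i = c w → i = 0 ∨ i = (p e).length := by
    intro e w i hi hw
    have := hmemB e _ w ((p e).getVert_mem_support i) (hw ▸ hcB w)
    rw [he e, Sym2.mem_iff] at this
    obtain rfl | rfl := this
    · left
      exact (hp e).getVert_injOn hi (Nat.zero_le _) (by rw [hw, SimpleGraph.Walk.getVert_zero])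
    · right
      exact (hp e).getVert_injOn hi (le_refl (p e).length) (by rw [hw, SimpleGraph.Walk.getVert_length])
  have hclosed : ∀ f q, q ∈ (p f).support → (∀ w, q ≠ c w) → ∀ r, K.Adj q r →
      r ∈ (p f).support := by
    intro f q hq hqc r hr
    obtain ⟨j, rfl, hj⟩ := SimpleGraph.Walk.mem_support_iff_exists_getVert.1 hq
    have hj0 : j ≠ 0 := by
      rintro rfl
      exact hqc _ (SimpleGraph.Walk.getVert_zero _)
    have hjl : j ≠ (p f).length := by
      rintro rfl
      exact hqc _ (SimpleGraph.Walk.getVert_length _)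
    obtain ⟨w, hw⟩ : ∃ w, (p f).getVert j ∈ B w := by
      obtain h' | h' := hsup f _ hq
      · exact ⟨_, h'⟩
      · exact ⟨_, h'⟩
    have h1 : K.Adj ((p f).getVert j) ((p f).getVert (j + 1)) := (p f).adj_getVert_succ (by omega)
    have h2 : K.Adj ((p f).getVert j) ((p f).getVert (j - 1)) := by
      have := (p f).adj_getVert_succ (i := j - 1) (by omega)
      rw [Nat.sub_add_cancel (by omega)] at this
      exact this.symm
    have h3 : (p f).getVert (j + 1) ≠ (p f).getVert (j - 1) := by
      intro h'
      have := (hp f).getVert_injOn (show j + 1 ≤ _ by omega) (show j - 1 ≤ (p f).length by omega) h'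
      omega
    have h4 : ({(p f).getVert (j + 1), (p f).getVert (j - 1)} : Set X) =
        K.neighborSet ((p f).getVert j) := by
      refine eq_of_subset_of_ncard_le ?_ ?_
      · rintro _ (rfl | rfl)
        · exact h1
        · exact h2
      · rw [ncard_pair h3]
        exact hdeg w _ hw (hqc w)
    have h5 : r ∈ K.neighborSet ((p f).getVert j) := hr
    rw [← h4] at h5
    obtain rfl | rfl := h5
    · exact (p f).getVert_mem_support _
    · exact (p f).getVert_mem_support _
  have hshare : ∀ e f, e ≠ f → ∀ q, q ∈ (p e).support → q ∈ (p f).support →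
      ∃ w, w ∈ (e : Sym2 V) ∧ w ∈ (f : Sym2 V) ∧ q = c w := by
    intro e f hef q hqe hqf
    by_cases hqc : ∃ w, q = c w
    · obtain ⟨w, rfl⟩ := hqc
      exact ⟨w, hmemB e _ w hqe (hcB w), hmemB f _ w hqf (hcB w), rfl⟩
    exfalso
    push Not at hqc
    obtain ⟨i, rfl, hi⟩ := SimpleGraph.Walk.mem_support_iff_exists_getVert.1 hqe
    have hi0 : i ≠ 0 := by
      rintro rfl
      exact hqc _ (SimpleGraph.Walk.getVert_zero _)
    have hil : i ≠ (p e).length := by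
      rintro rfl
      exact hqc _ (SimpleGraph.Walk.getVert_length _)
    -- Followed from the shared vertex in either direction, `p e` stays inside `p f` until it
    -- reaches a centre, and centres occur only at its two ends.
    have hup : ∀ k, i + k ≤ (p e).length → (p e).getVert (i + k) ∈ (p f).support := by
      intro k
      induction k with
      | zero => exact fun _ => hqf
      | succ k ih =>
        intro hk
        refine hclosed f _ (ih (by omega)) (fun w hw => ?_) _
          ((p e).adj_getVert_succ (by omega))
        have := hends e w _ (by omega) hw
        omega
    have hdown : ∀ k, k ≤ i → (p e).getVert (i - k) ∈ (p f).support := by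
      intro k
      induction k with
      | zero => exact fun _ => hqf
      | succ k ih =>
        intro hk
        refine hclosed f _ (ih (by omega)) (fun w hw => ?_) _ ?_
        · have := hends e w _ (by omega) hw
          omega
        · have := (p e).adj_getVert_succ (i := i - (k + 1)) (by omega)
          rw [show i - (k + 1) + 1 = i - k by omega] at this
          exact this.symm
    have h1 := hdown i le_rfl
    rw [Nat.sub_self, SimpleGraph.Walk.getVert_zero] at h1
    have h2 := hup ((p e).length - i) (by omega)
    rw [show i + ((p e).length - i) = (p e).length by omega,
      SimpleGraph.Walk.getVert_length] at h2
    refine hef (Subtype.ext ?_)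
    rw [he e]
    exact ((Sym2.mem_and_mem_iff (huv e)).1
      ⟨hmemB f _ _ h1 (hcB _), hmemB f _ _ h2 (hcB _)⟩).symm
  refine ⟨⟨fun w => D.point (c w), D.point_injective.comp hcinj,
    fun e => D.arcOfPath (p e) (hp e) (hcuv e), ?_, ?_, ?_⟩⟩
  · intro e
    rw [he e, Sym2.map_mk]
    change s(D.point ((p e).getVert 0), D.point ((p e).getVert (p e).length)) = _
    rw [SimpleGraph.Walk.getVert_zero, SimpleGraph.Walk.getVert_length]
  · intro e w hw
    obtain ⟨a, ha, b, hb, hab, hz⟩ := D.mem_trace_arcOfPath hw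
    by_cases h1 : c w = a
    · exact hmemB e a w ha (h1 ▸ hcB w)
    by_cases h2 : c w = b
    · exact hmemB e b w hb (h2 ▸ hcB w)
    exact absurd hz (D.point_notMem hab h1 h2)
  · rintro e f hef z ⟨hz, hz'⟩
    obtain ⟨a, ha, b, hb, hab, hz⟩ := D.mem_trace_arcOfPath hz
    obtain ⟨a', ha', b', hb', hab', hz'⟩ := D.mem_trace_arcOfPath hz'
    obtain heq | ⟨q, hq, hq', rfl⟩ := D.eq_or_exists_of_mem hab hab' hz hz'
    -- A common segment would have two distinct shared ends, hence two distinct centres common to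
    -- `e` and `f`, which forces `e = f`.
    · exfalso
      have hab2 : a ∈ (p f).support ∧ b ∈ (p f).support := by
        obtain ⟨rfl, rfl⟩ | ⟨rfl, rfl⟩ := Sym2.eq_iff.1 heq
        · exact ⟨ha', hb'⟩
        · exact ⟨hb', ha'⟩
      obtain ⟨w, h1, h2, rfl⟩ := hshare e f hef a ha hab2.1
      obtain ⟨w', h1', h2', rfl⟩ := hshare e f hef b hb hab2.2
      exact hef (Subtype.ext (Sym2.eq_of_ne_mem (fun e => hab.ne (congrArg c e)) h1 h1' h2 h2'))
    · have h1 : q ∈ (p e).support := by obtain rfl | rfl := hq <;> assumption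
      have h2 : q ∈ (p f).support := by obtain rfl | rfl := hq' <;> assumption
      obtain ⟨w, hw, hw', rfl⟩ := hshare e f hef q h1 h2
      exact ⟨w, hw, hw', rfl⟩

/-- A minor of a finite graph with a straight-line drawing is planar. -/
theorem IsStraight.isPlanar_of_isMinor {V : Type*} {X : Type} [Finite X] {G : SimpleGraph V}
    {K : SimpleGraph X} (hK : IsStraight K) (h : IsMinor G K) : IsPlanar G := by
  obtain ⟨B, h1, h2, h3⟩ := h
  have : HasCoreModel G (⋃ v, B v).ncard :=
    ⟨X, inferInstance, K, B, B, hK, ⟨h1, fun _ => Subset.rfl, h1, h2, h3⟩,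
      fun v q hq hq' => absurd hq hq', le_rfl⟩
  obtain ⟨X', _, K', c, B', hK', hM, hdeg⟩ := exists_star_model this
  exact isPlanar_of_star_model hK' hM hdeg

/-! ### Cutting a drawing at its bends. -/

namespace PolyArc

variable (γ : PolyArc)

theorem segment_subset_trace {i : ℕ} (hi : i < γ.len) :
    segment ℝ (γ.pt i) (γ.pt (i + 1)) ⊆ γ.trace := fun _ hz =>
  mem_iUnion₂.2 ⟨i, hi, hz⟩

theorem pt_mem_trace {i : ℕ} (hi : i ≤ γ.len) : γ.pt i ∈ γ.trace := by
  rcases hi.lt_or_eq with h | rfl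
  · exact γ.segment_subset_trace h (left_mem_segment _ _ _)
  · have h := γ.len_pos
    have := γ.segment_subset_trace (i := γ.len - 1) (by omega) (right_mem_segment _ _ _)
    rwa [Nat.sub_add_cancel h] at this

theorem eq_pt_of_mem_segments {i j : ℕ} (hij : i < j) (hj : j < γ.len) {z : Plane}
    (hz : z ∈ segment ℝ (γ.pt i) (γ.pt (i + 1)))
    (hz' : z ∈ segment ℝ (γ.pt j) (γ.pt (j + 1))) : j = i + 1 ∧ z = γ.pt (i + 1) := by
  obtain h | rfl : i + 1 < j ∨ j = i + 1 := by omega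
  · exact absurd hz' (Set.disjoint_left.1 (γ.nonconsecutive i j h hj) hz)
  · refine ⟨rfl, ?_⟩
    rw [← mem_singleton_iff, ← γ.consecutive i hj]
    exact ⟨hz, hz'⟩

theorem pt_mem_segment {i j : ℕ} (hi : i < γ.len) (hj : j ≤ γ.len)
    (h : γ.pt j ∈ segment ℝ (γ.pt i) (γ.pt (i + 1))) : γ.pt j = γ.pt i ∨ γ.pt j = γ.pt (i + 1) := by
  obtain hlt | rfl | rfl | hgt : j < i ∨ j = i ∨ j = i + 1 ∨ i + 1 < j := by omega
  · have := γ.eq_pt_of_mem_segments hlt hi (left_mem_segment _ _ _) h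
    left
    rw [this.2, this.1]
  · exact Or.inl rfl
  · exact Or.inr rfl
  · right
    have h2 := right_mem_segment ℝ (γ.pt (j - 1)) (γ.pt (j - 1 + 1))
    rw [Nat.sub_add_cancel (by omega)] at h2
    have h3 := γ.eq_pt_of_mem_segments (i := i) (j := j - 1) (by omega) (by omega) h
      (by rwa [Nat.sub_add_cancel (by omega)])
    exact h3.2

theorem pt_ne {i j : ℕ} (hij : i < j) (hj : j ≤ γ.len) : γ.pt i ≠ γ.pt j := by
  intro h
  obtain rfl | hgt : j = i + 1 ∨ i + 1 < j := by omega
  · exact γ.nondegenerate i (by omega) h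
  · have h2 := right_mem_segment ℝ (γ.pt (j - 1)) (γ.pt (j - 1 + 1))
    have h3 := γ.eq_pt_of_mem_segments (i := i) (j := j - 1) (by omega) (by omega)
      (left_mem_segment _ _ _) (by rw [h]; rwa [Nat.sub_add_cancel (by omega)] at h2 ⊢)
    exact γ.nondegenerate i (by omega) h3.2

end PolyArc

namespace PlaneDrawing

variable {V : Type*} {H : SimpleGraph V} (D : PlaneDrawing H)

theorem exists_ends (e : H.edgeSet) : ∃ u v, (e : Sym2 V) = s(u, v) ∧ u ≠ v ∧
    (D.arc e).pt 0 = D.pos u ∧ (D.arc e).pt (D.arc e).len = D.pos v := by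
  obtain ⟨⟨u, v⟩, he⟩ := e
  have hne : u ≠ v := SimpleGraph.Adj.ne (G := H) he
  have h := D.arc_ends ⟨s(u, v), he⟩
  rw [Sym2.map_mk] at h
  obtain ⟨h1, h2⟩ | ⟨h1, h2⟩ := Sym2.eq_iff.1 h
  · exact ⟨u, v, rfl, hne, h1, h2⟩
  · exact ⟨v, u, Sym2.eq_swap, hne.symm, h1, h2⟩

theorem pos_eq_end {e : H.edgeSet} {v : V} (h : D.pos v ∈ (D.arc e).trace) :
    D.pos v = (D.arc e).pt 0 ∨ D.pos v = (D.arc e).pt (D.arc e).len := by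
  have hv := D.vertex_mem_arc e v h
  obtain ⟨a, b, he, -, h0, h1⟩ := D.exists_ends e
  rw [he, Sym2.mem_iff] at hv
  obtain rfl | rfl := hv
  · exact Or.inl h0.symm
  · exact Or.inr h1.symm

theorem pt_ne_pos {e : H.edgeSet} {i : ℕ} (h0 : 0 < i) (hi : i < (D.arc e).len) (v : V) :
    (D.arc e).pt i ≠ D.pos v := by
  intro h
  have := D.pos_eq_end (e := e) (v := v) (h ▸ (D.arc e).pt_mem_trace hi.le)
  rw [← h] at this
  obtain h' | h' := this
  · exact (D.arc e).pt_ne h0 hi.le h'.symm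
  · exact (D.arc e).pt_ne hi le_rfl h'

/-- The vertices and bends of a drawing. -/
def nodes : Set Plane :=
  range D.pos ∪ ⋃ e, (D.arc e).pt '' Iic (D.arc e).len

theorem finite_nodes [Finite V] : D.nodes.Finite :=
  (finite_range _).union (finite_iUnion fun _ => (finite_Iic _).image _)

theorem pos_mem_nodes (v : V) : D.pos v ∈ D.nodes := Or.inl ⟨v, rfl⟩

theorem pt_mem_nodes (e : H.edgeSet) {i : ℕ} (hi : i ≤ (D.arc e).len) :
    (D.arc e).pt i ∈ D.nodes := Or.inr (mem_iUnion.2 ⟨e, i, hi, rfl⟩)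

/-- An arc passes through vertices only at its ends, and two arcs meet only in vertices. So no bend
or vertex can lie in the interior of a segment. -/
theorem node_mem_segment {r : Plane} (hr : r ∈ D.nodes) {e : H.edgeSet} {i : ℕ}
    (hi : i < (D.arc e).len) (h : r ∈ segment ℝ ((D.arc e).pt i) ((D.arc e).pt (i + 1))) :
    r = (D.arc e).pt i ∨ r = (D.arc e).pt (i + 1) := by
  have hvert : ∀ v, r = D.pos v → r = (D.arc e).pt i ∨ r = (D.arc e).pt (i + 1) := by
    rintro v rfl
    obtain h' | h' := D.pos_eq_end ((D.arc e).segment_subset_trace hi h)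
    · rw [h'] at h ⊢
      exact (D.arc e).pt_mem_segment hi (Nat.zero_le _) h
    · rw [h'] at h ⊢
      exact (D.arc e).pt_mem_segment hi le_rfl h
  obtain ⟨v, hv⟩ | hr := hr
  · exact hvert v hv.symm
  · obtain ⟨f, j, hj, rfl⟩ := mem_iUnion.1 hr
    by_cases hef : e = f
    · subst hef
      exact (D.arc e).pt_mem_segment hi hj h
    · obtain ⟨v, -, -, hv⟩ := D.arc_inter e f hef _
        ⟨(D.arc e).segment_subset_trace hi h, (D.arc f).pt_mem_trace hj⟩
      exact hvert v hv

/-- The graph whose edges are the segments of the arcs of a drawing. -/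
def segmentGraph : SimpleGraph D.nodes where
  Adj p q := p ≠ q ∧ ∃ e, ∃ i < (D.arc e).len,
    s((p : Plane), (q : Plane)) = s((D.arc e).pt i, (D.arc e).pt (i + 1))
  symm := ⟨by
    rintro p q ⟨h, e, i, hi, he⟩
    exact ⟨h.symm, e, i, hi, Sym2.eq_swap.trans he⟩⟩
  loopless := ⟨fun _ h => h.1 rfl⟩

theorem segmentGraph_adj {e : H.edgeSet} {i : ℕ} (hi : i < (D.arc e).len) :
    D.segmentGraph.Adj ⟨_, D.pt_mem_nodes e hi.le⟩ ⟨_, D.pt_mem_nodes e hi⟩ :=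
  ⟨fun h => (D.arc e).nondegenerate i hi (congrArg Subtype.val h), e, i, hi, rfl⟩

theorem segment_eq_of_sym2 {a b c d : Plane} (h : s(a, b) = s(c, d)) :
    segment ℝ a b = segment ℝ c d := by
  obtain ⟨rfl, rfl⟩ | ⟨rfl, rfl⟩ := Sym2.eq_iff.1 h
  · rfl
  · exact segment_symm _ _ _

/-- A common point of two distinct segments is a node: a bend if they belong to the same arc, a
vertex otherwise. By `node_mem_segment` it is then an end of both. -/
theorem isStraight_segmentGraph : IsStraight D.segmentGraph := by
  have himg : ∀ a b : Plane, segment ℝ (toPlane.symm a) (toPlane.symm b) =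
      toPlane.symm '' segment ℝ a b := fun a b =>
    (image_segment ℝ toPlane.symm.toLinearMap.toAffineMap a b).symm
  have hnode : ∀ a b c : D.nodes, D.segmentGraph.Adj a b →
      (c : Plane) ∈ segment ℝ (a : Plane) b → c = a ∨ c = b := by
    rintro a b c ⟨-, e, i, hi, he⟩ hc
    rw [segment_eq_of_sym2 he] at hc
    have : (c : Plane) ∈ s((a : Plane), (b : Plane)) := by
      rw [he, Sym2.mem_iff]
      exact D.node_mem_segment c.2 hi hc
    exact (Sym2.mem_iff.1 this).imp Subtype.ext Subtype.ext
  refine ⟨⟨fun p => toPlane.symm p, toPlane.symm.injective.comp Subtype.val_injective, ?_, ?_⟩⟩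
  · intro a b v hab hva hvb h
    rw [himg, toPlane.symm.injective.mem_set_image] at h
    exact (hnode a b v hab h).elim hva hvb
  · intro a b c d hab hcd h1 h2 h3 h4
    rw [himg, himg]
    refine (disjoint_image_iff toPlane.symm.injective).2 (Set.disjoint_left.2 fun z hz hz' => ?_)
    suffices z ∈ D.nodes by
      have e1 := hnode a b ⟨z, this⟩ hab hz
      have e2 := hnode c d ⟨z, this⟩ hcd hz'
      obtain e1 | e1 := e1 <;> obtain e2 | e2 := e2
      · exact h1 (e1.symm.trans e2)
      · exact h2 (e1.symm.trans e2)
      · exact h3 (e1.symm.trans e2)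
      · exact h4 (e1.symm.trans e2)
    obtain ⟨-, e, i, hi, he⟩ := hab
    obtain ⟨-, f, j, hj, hf⟩ := hcd
    rw [segment_eq_of_sym2 he] at hz
    rw [segment_eq_of_sym2 hf] at hz'
    by_cases hef : e = f
    · subst hef
      obtain hlt | rfl | hgt := lt_trichotomy i j
      · rw [((D.arc e).eq_pt_of_mem_segments hlt hj hz hz').2]
        exact D.pt_mem_nodes e hi
      · rw [← hf] at he
        obtain ⟨e1, -⟩ | ⟨e1, -⟩ := Sym2.eq_iff.1 he
        · exact absurd (Subtype.ext e1) h1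
        · exact absurd (Subtype.ext e1) h2
      · rw [((D.arc e).eq_pt_of_mem_segments hgt hi hz' hz).2]
        exact D.pt_mem_nodes e hj
    · obtain ⟨v, -, -, rfl⟩ := D.arc_inter e f hef z
        ⟨(D.arc e).segment_subset_trace hi hz, (D.arc f).segment_subset_trace hj hz'⟩
      exact D.pos_mem_nodes v

/-- Every planar graph is a minor of a straight-line graph, with branch sets that cover all
vertices, the one of a given vertex being a singleton. -/
theorem exists_straight_model [Finite V] (D : PlaneDrawing H) (x : V) :
    ∃ (X : Type) (_ : Finite X) (K : SimpleGraph X) (B : V → Set X), IsStraight K ∧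
      CoreModel H K B B ∧ (∀ p, ∃ v, p ∈ B v) ∧ ∃ y, B x = {y} := by
  -- The inner bends of an edge `e` are given to the branch set of one end `d e`. Choosing this end
  -- different from `x` leaves the branch set of `x` with a single point.
  have hd : ∀ e : H.edgeSet, ∃ v ∈ (e : Sym2 V), v ≠ x := by
    intro e
    obtain ⟨u, v, he, huv, -⟩ := D.exists_ends e
    rw [he]
    by_cases hu : u = x
    · exact ⟨v, Sym2.mem_mk_right _ _, fun h => huv (hu.trans h.symm)⟩
    · exact ⟨u, Sym2.mem_mk_left _ _, hu⟩
  choose d hde hdx using hd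
  let B : V → Set D.nodes := fun z => {p | (p : Plane) = D.pos z ∨
    ∃ e, d e = z ∧ ∃ i, 0 < i ∧ i < (D.arc e).len ∧ (p : Plane) = (D.arc e).pt i}
  have hposB : ∀ v, (⟨D.pos v, D.pos_mem_nodes v⟩ : D.nodes) ∈ B v := fun v => Or.inl rfl
  have hconn : ∀ z, (D.segmentGraph.induce (B z)).Connected := by
    intro z
    refine induce_connected_iff.2 ⟨⟨_, hposB z⟩, fun T hT hcl => ?_⟩
    have hstep : ∀ (e : H.edgeSet) (i : ℕ) (hi : i < (D.arc e).len),
        (⟨_, D.pt_mem_nodes e hi.le⟩ : D.nodes) ∈ B z → (⟨_, D.pt_mem_nodes e hi⟩ : D.nodes) ∈ B z →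
        ((⟨_, D.pt_mem_nodes e hi.le⟩ : D.nodes) ∈ T ↔ (⟨_, D.pt_mem_nodes e hi⟩ : D.nodes) ∈ T) :=
      fun e i hi h1 h2 => ⟨fun h => hcl _ h1 h _ h2 (D.segmentGraph_adj hi),
        fun h => hcl _ h2 h _ h1 (D.segmentGraph_adj hi).symm⟩
    have hall : ∀ p ∈ B z, (p ∈ T ↔ (⟨D.pos z, D.pos_mem_nodes z⟩ : D.nodes) ∈ T) := by
      rintro ⟨p, hp⟩ (h | ⟨e, hez, i, hi0, hi, h⟩)
      · change p = _ at h
        subst h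
        rfl
      · change p = _ at h
        subst h
        have hin : ∀ j (hj0 : 0 < j) (hj : j < (D.arc e).len),
            (⟨_, D.pt_mem_nodes e hj.le⟩ : D.nodes) ∈ B z := fun j hj0 hj =>
          Or.inr ⟨e, hez, j, hj0, hj, rfl⟩
        obtain ⟨u, v, he, huv, h0, h1⟩ := D.exists_ends e
        have hm := hde e
        rw [he, hez, Sym2.mem_iff] at hm
        obtain rfl | rfl := hm
        · have hz0 : (⟨_, D.pt_mem_nodes e (Nat.zero_le _)⟩ : D.nodes) ∈ B z := Or.inl h0
          have key : ∀ j (hj : j < (D.arc e).len), ((⟨_, D.pt_mem_nodes e hj.le⟩ : D.nodes) ∈ T ↔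
              (⟨_, D.pt_mem_nodes e (Nat.zero_le _)⟩ : D.nodes) ∈ T) := by
            intro j
            induction j with
            | zero => exact fun _ => Iff.rfl
            | succ j ih =>
              intro hj
              rw [← ih (by omega)]
              refine (hstep e j (by omega) ?_ (hin _ (by omega) hj)).symm
              rcases Nat.eq_zero_or_pos j with rfl | hj0
              · exact hz0
              · exact hin j hj0 (by omega)
          rw [key i hi]
          simp only [h0]
        · have hz0 : (⟨_, D.pt_mem_nodes e le_rfl⟩ : D.nodes) ∈ B z := Or.inl h1
          have key : ∀ k j (hj : j ≤ (D.arc e).len), 0 < j → j + k = (D.arc e).len →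
              ((⟨_, D.pt_mem_nodes e hj⟩ : D.nodes) ∈ T ↔
              (⟨_, D.pt_mem_nodes e le_rfl⟩ : D.nodes) ∈ T) := by
            intro k
            induction k with
            | zero =>
              rintro j hj - rfl
              rfl
            | succ k ih =>
              intro j hj hj0 hjk
              rw [← ih (j + 1) (by omega) (by omega) (by omega)]
              refine hstep e j (by omega) (hin j hj0 (by omega)) ?_
              obtain hlt | heq : j + 1 < (D.arc e).len ∨ j + 1 = (D.arc e).len := by omega
              · exact hin _ (by omega) hlt
              · refine Or.inl ?_
                change (D.arc e).pt (j + 1) = _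
                rw [heq, h1]
          rw [key ((D.arc e).len - i) i hi.le hi0 (by omega)]
          simp only [h1]
    obtain ⟨a, haB, haT⟩ := hT
    exact fun b hb => (hall b hb).2 ((hall a haB).1 haT)
  have hadj : ∀ e : H.edgeSet, ∀ b, b ∈ (e : Sym2 V) → b ≠ d e →
      ∃ p ∈ B (d e), ∃ q ∈ B b, D.segmentGraph.Adj p q := by
    intro e b hb hbd
    have hlen := (D.arc e).len_pos
    obtain ⟨u, v, he, huv, h0, h1⟩ := D.exists_ends e
    have hm := hde e
    rw [he, Sym2.mem_iff] at hm hb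
    obtain hm | hm := hm
    · have hbv : b = v := hb.resolve_left fun h => hbd (h.trans hm.symm)
      have := D.segmentGraph_adj (e := e) (i := (D.arc e).len - 1) (by omega)
      refine ⟨_, ?_, _, ?_, this⟩
      · rcases Nat.eq_zero_or_pos ((D.arc e).len - 1) with h | h
        · left; change (D.arc e).pt _ = _; rw [h, h0, hm]
        · exact Or.inr ⟨e, rfl, _, h, by omega, rfl⟩
      · left; change (D.arc e).pt ((D.arc e).len - 1 + 1) = _; rw [Nat.sub_add_cancel hlen, h1, hbv]
    · have hbu : b = u := hb.resolve_right fun h => hbd (h.trans hm.symm)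
      have := D.segmentGraph_adj (e := e) (i := 0) (by omega)
      refine ⟨_, ?_, _, ?_, this.symm⟩
      · obtain h | h : 0 + 1 = (D.arc e).len ∨ 1 < (D.arc e).len := by omega
        · left; change (D.arc e).pt (0 + 1) = _; rw [h, h1, hm]
        · exact Or.inr ⟨e, rfl, _, Nat.one_pos, h, rfl⟩
      · left; change (D.arc e).pt _ = _; rw [h0, hbu]
  refine ⟨D.nodes, D.finite_nodes.to_subtype, D.segmentGraph, B, D.isStraight_segmentGraph,
    ⟨hconn, fun _ => Subset.rfl, hconn, ?_, ?_⟩, ?_, ⟨D.pos x, D.pos_mem_nodes x⟩, ?_⟩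
  · intro u v huv
    rw [Set.disjoint_left]
    rintro ⟨p, hp⟩ (h | ⟨e, he, i, hi0, hi, h⟩) (h' | ⟨f, hf, j, hj0, hj, h'⟩)
    · exact huv (D.pos_injective (h.symm.trans h'))
    · exact D.pt_ne_pos hj0 hj u (h'.symm.trans h)
    · exact D.pt_ne_pos hi0 hi v (h.symm.trans h')
    · by_cases hef : e = f
      · subst hef; exact huv (he.symm.trans hf)
      · obtain ⟨w, -, -, hw⟩ := D.arc_inter e f hef p
          ⟨by change p = _ at h; rw [h]; exact (D.arc e).pt_mem_trace hi.le,
            by change p = _ at h'; rw [h']; exact (D.arc f).pt_mem_trace hj.le⟩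
        exact D.pt_ne_pos hi0 hi w (h.symm.trans hw)
  · intro u v huv
    have hm := hde ⟨s(u, v), huv⟩
    obtain hm | hm := Sym2.mem_iff.1 hm
    · have := hadj ⟨s(u, v), huv⟩ v (Sym2.mem_mk_right _ _) (by rw [hm]; exact huv.ne')
      rwa [hm] at this
    · obtain ⟨p, hp, q, hq, hpq⟩ :=
        hadj ⟨s(u, v), huv⟩ u (Sym2.mem_mk_left _ _) (by rw [hm]; exact huv.ne)
      rw [hm] at hp
      exact ⟨q, hq, p, hp, hpq.symm⟩
  · rintro ⟨p, ⟨v, rfl⟩ | hp⟩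
    · exact ⟨v, hposB v⟩
    · obtain ⟨e, i, hi, rfl⟩ := mem_iUnion.1 hp
      obtain ⟨u, v, -, -, h0, h1⟩ := D.exists_ends e
      obtain rfl | h | h : i = 0 ∨ i = (D.arc e).len ∨ (0 < i ∧ i < (D.arc e).len) := by
        have : i ≤ (D.arc e).len := hi
        omega
      · exact ⟨u, Or.inl h0⟩
      · exact ⟨v, Or.inl (h ▸ h1)⟩
      · exact ⟨d e, Or.inr ⟨e, rfl, i, h.1, h.2, rfl⟩⟩
  · ext ⟨p, hp⟩
    constructor
    · rintro (h | ⟨e, he, -⟩)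
      · exact Subtype.ext h
      · exact absurd he (hdx e)
    · intro h
      exact Or.inl (congrArg Subtype.val h)

end PlaneDrawing

/-! ### Minors -/

theorem IsMinor.trans {U V W : Type*} {F : SimpleGraph U} {G : SimpleGraph V} {H : SimpleGraph W}
    (hFG : IsMinor F G) (hGH : IsMinor G H) : IsMinor F H := by
  obtain ⟨B, hB1, hB2, hB3⟩ := hFG
  obtain ⟨C, hC1, hC2, hC3⟩ := hGH
  refine ⟨fun u => ⋃ v ∈ B u, C v, fun u => ?_, fun u u' huu => ?_, fun u u' huu => ?_⟩
  · have h := induce_connected_iff.1 (hB1 u)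
    obtain ⟨v, hv⟩ := h.1
    obtain ⟨w, hw⟩ := (induce_connected_iff.1 (hC1 v)).1
    refine induce_connected_iff.2 ⟨⟨w, mem_iUnion₂.2 ⟨v, hv, hw⟩⟩, fun T hT hcl => ?_⟩
    have hC : ∀ v ∈ B u, (C v ∩ T).Nonempty → C v ⊆ T := fun v hv hne =>
      (induce_connected_iff.1 (hC1 v)).2 T hne fun a ha haT b hb hab =>
        hcl a (mem_iUnion₂.2 ⟨v, hv, ha⟩) haT b (mem_iUnion₂.2 ⟨v, hv, hb⟩) hab
    obtain ⟨a, ha, haT⟩ := hT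
    obtain ⟨v₀, hv₀, ha⟩ := mem_iUnion₂.1 ha
    have hall := h.2 {v | C v ⊆ T} ⟨v₀, hv₀, hC v₀ hv₀ ⟨a, ha, haT⟩⟩ (by
      intro v hv hvT v' hv' hvv
      obtain ⟨x, hx, y, hy, hxy⟩ := hC3 v v' hvv
      exact hC v' hv' ⟨y, hy, hcl x (mem_iUnion₂.2 ⟨v, hv, hx⟩) (hvT hx) y
        (mem_iUnion₂.2 ⟨v', hv', hy⟩) hxy⟩)
    exact iUnion₂_subset fun v hv => hall hv
  · rw [Set.disjoint_left]
    intro w hw hw'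
    obtain ⟨v, hv, hw⟩ := mem_iUnion₂.1 hw
    obtain ⟨v', hv', hw'⟩ := mem_iUnion₂.1 hw'
    have hvv : v ≠ v' := by
      rintro rfl
      exact Set.disjoint_left.1 (hB2 u u' huu) hv hv'
    exact Set.disjoint_left.1 (hC2 v v' hvv) hw hw'
  · obtain ⟨v, hv, v', hv', hvv⟩ := hB3 u u' huu
    obtain ⟨x, hx, y, hy, hxy⟩ := hC3 v v' hvv
    exact ⟨x, mem_iUnion₂.2 ⟨v, hv, hx⟩, y, mem_iUnion₂.2 ⟨v', hv', hy⟩, hxy⟩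

theorem isMinor_of_injective {V W : Type*} {G : SimpleGraph V} {H : SimpleGraph W} (f : V → W)
    (hf : Function.Injective f) (h : ∀ u v, G.Adj u v → H.Adj (f u) (f v)) : IsMinor G H :=
  ⟨fun v => {f v}, fun _ => induce_connected_singleton,
    fun _ _ huv => disjoint_singleton.2 (hf.ne huv), fun u v huv => ⟨_, rfl, _, rfl, h u v huv⟩⟩

theorem isMinor_of_le {V : Type*} {G H : SimpleGraph V} (h : G ≤ H) : IsMinor G H :=
  isMinor_of_injective id Function.injective_id fun _ _ huv => h huv

/-- Contracting the new vertex of a split graph into the vertex `u`. -/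
theorem isMinor_splitVertex_of {V : Type*} {G H : SimpleGraph V} {x u : V} {S T : Set V}
    (hu : u = x ∨ (H.Adj x u ∧ u ∈ T))
    (h : ∀ a b, G.Adj a b → (splitVertex H x S T).Adj (some a) (some b) ∨
      (a = u ∧ (splitVertex H x S T).Adj none (some b)) ∨
      (b = u ∧ (splitVertex H x S T).Adj (some a) none)) :
    IsMinor G (splitVertex H x S T) := by
  refine ⟨fun z => {p | p = some z ∨ (p = none ∧ z = u)}, fun z => ?_, fun a b hab => ?_,
    fun a b hab => ?_⟩
  · refine induce_connected_iff.2 ⟨⟨some z, Or.inl rfl⟩, fun Q hQ hcl => ?_⟩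
    have h1 : z = u → (some z ∈ Q ↔ none ∈ Q) := by
      rintro rfl
      exact ⟨fun hz => hcl _ (Or.inl rfl) hz _ (Or.inr ⟨rfl, rfl⟩) hu,
        fun hz => hcl _ (Or.inr ⟨rfl, rfl⟩) hz _ (Or.inl rfl) hu⟩
    have h2 : some z ∈ Q := by
      obtain ⟨_, rfl | ⟨rfl, hz⟩, hQ⟩ := hQ
      · exact hQ
      · exact (h1 hz).2 hQ
    rintro _ (rfl | ⟨rfl, hz⟩)
    · exact h2
    · exact (h1 hz).1 h2
  · rw [Set.disjoint_left]
    rintro _ (rfl | ⟨rfl, rfl⟩) (h' | ⟨h', h''⟩)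
    · exact hab (Option.some_injective _ h')
    · simp at h'
    · simp at h'
    · exact hab h''.symm
  · obtain h' | ⟨rfl, h'⟩ | ⟨rfl, h'⟩ := h a b hab
    · exact ⟨_, Or.inl rfl, _, Or.inl rfl, h'⟩
    · exact ⟨_, Or.inr ⟨rfl, rfl⟩, _, Or.inl rfl, h'⟩
    · exact ⟨_, Or.inl rfl, _, Or.inr ⟨rfl, rfl⟩, h'⟩

theorem isMinor_splitVertex {V : Type*} {H : SimpleGraph V} {x : V} {S T : Set V}
    (h : H.neighborSet x ⊆ S ∪ T) : IsMinor H (splitVertex H x S T) := by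
  refine isMinor_splitVertex_of (u := x) (Or.inl rfl) fun a b hab => ?_
  by_cases ha : a = x
  · subst ha
    obtain hb | hb := h hab
    · exact Or.inl ⟨hab, fun _ => hb, fun e => absurd e hab.ne'⟩
    · exact Or.inr (Or.inl ⟨rfl, Or.inr ⟨hab, hb⟩⟩)
  by_cases hb : b = x
  · subst hb
    obtain ha' | ha' := h hab.symm
    · exact Or.inl ⟨hab, fun e => absurd e ha, fun _ => ha'⟩
    · exact Or.inr (Or.inr ⟨rfl, Or.inr ⟨hab.symm, ha'⟩⟩)
  · exact Or.inl ⟨hab, fun e => absurd e ha, fun e => absurd e hb⟩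

/-! ### Planar graphs -/

theorem CoreModel.isMinor {V X : Type*} {G : SimpleGraph V} {K : SimpleGraph X} {A B : V → Set X}
    (h : CoreModel G K A B) : IsMinor G K := ⟨B, h.conn, h.disj, h.adj⟩

theorem IsPlanar.of_isMinor {V W : Type*} [Finite W] {G : SimpleGraph V} {H : SimpleGraph W}
    (hH : IsPlanar H) (h : IsMinor G H) : IsPlanar G := by
  obtain ⟨D⟩ := hH
  -- The straight model needs a base vertex, hence the separate empty case.
  cases isEmpty_or_nonempty W with
  | inl _ =>
    have hV : IsEmpty V := by
      obtain ⟨B, hB, -⟩ := h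
      exact ⟨fun v => isEmptyElim (Set.nonempty_coe_sort.1 (hB v).nonempty).some⟩
    have hE : IsEmpty G.edgeSet := ⟨fun e => e.1.ind fun v _ => hV.elim v⟩
    exact ⟨⟨hV.elim, fun v => hV.elim v, hE.elim, fun e => hE.elim e, fun e => hE.elim e,
      fun e => hE.elim e⟩⟩
  | inr hW =>
    obtain ⟨X, _, K, B, hK, hM, -⟩ := D.exists_straight_model hW.some
    exact hK.isPlanar_of_isMinor (h.trans hM.isMinor)

theorem IsPlanar.mono {V : Type*} [Finite V] {G H : SimpleGraph V} (h : G ≤ H) (hH : IsPlanar H) :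
    IsPlanar G := hH.of_isMinor (isMinor_of_le h)

theorem isPlanar_bot (n : ℕ) : IsPlanar (⊥ : SimpleGraph (Fin n)) := by
  have : IsStraight (⊥ : SimpleGraph (Fin n)) :=
    ⟨⟨fun i => ((i : ℕ) : ℂ), fun i j h => Fin.ext (Nat.cast_injective h), fun _ _ _ h => h.elim,
      fun _ _ _ _ h => h.elim⟩⟩
  exact this.isPlanar_of_isMinor (isMinor_of_le le_rfl)

/-- The neighbours of a vertex `x` of a planar graph have a linear order `θ`, such that splitting
`x` along any two of them preserves planarity. -/
theorem IsPlanar.exists_angle {V : Type*} [Finite V] {H : SimpleGraph V} (hH : IsPlanar H)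
    (x : V) : ∃ θ : V → ℝ, InjOn θ (H.neighborSet x) ∧
      ∀ u ∈ H.neighborSet x, ∀ v ∈ H.neighborSet x, u ≠ v →
        IsPlanar (splitVertex H x {z | θ z ∉ uIoo (θ u) (θ v)} {z | θ z ∈ uIcc (θ u) (θ v)}) := by
  obtain ⟨D⟩ := hH
  obtain ⟨X, _, K, B, hK, hM, -, y, hy⟩ := D.exists_straight_model x
  obtain ⟨θ, hinj, hs⟩ := hK.exists_angle y
  have hnb : ∀ z, ∃ p, H.Adj x z → p ∈ B z ∧ K.Adj y p := by
    intro z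
    by_cases h : H.Adj x z
    · obtain ⟨a, ha, b, hb, hab⟩ := hM.adj x z h
      rw [hy, mem_singleton_iff] at ha
      subst ha
      exact ⟨b, fun _ => ⟨hb, hab⟩⟩
    · exact ⟨y, fun h' => absurd h' h⟩
  -- Each neighbour `z` of `x` is represented by a vertex `nb z` of its branch set adjacent to `y`,
  -- and inherits its angle. Branch sets are disjoint, so representatives are distinct. For other
  -- `z` the value is irrelevant.
  choose nb hnb using hnb
  have hnbinj : ∀ u v, H.Adj x u → H.Adj x v → nb u = nb v → u = v := by
    intro u v hu hv huv
    exact hM.eq_of_mem (hnb u hu).1 (huv ▸ (hnb v hv).1)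
  refine ⟨θ ∘ nb, fun u hu v hv huv =>
    hnbinj u v hu hv (hinj (hnb u hu).2 (hnb v hv).2 huv), fun u hu v hv huv => ?_⟩
  refine (hs (nb u) (hnb u hu).2 (nb v) (hnb v hv).2
    fun e => huv (hnbinj u v hu hv e)).isPlanar_of_isMinor ?_
  have hyB : ∀ z, y ∈ B z → z = x := fun z hz => hM.eq_of_mem hz (hy ▸ rfl : y ∈ B x)
  have hyx : y ∈ B x := hy ▸ rfl
  -- Because the branch set of `x` is `{y}`, splitting `y` splits `x`: the new vertex of one graph
  -- models the new vertex of the other.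
  refine ⟨fun o => o.elim {none} fun z => some '' B z, ?_, ?_, ?_⟩
  · rintro (_ | z)
    · exact induce_connected_singleton
    · by_cases hz : z = x
      · subst hz
        change (SimpleGraph.induce (some '' B z) _).Connected
        rw [hy, image_singleton]
        exact induce_connected_singleton
      · refine induce_connected_image (hM.conn z) _ fun a ha b hb hab => ⟨hab, ?_, ?_⟩
        · rintro rfl
          exact absurd (hyB z ha) hz
        · rintro rfl
          exact absurd (hyB z hb) hz
  · rintro (_ | a) (_ | b) hab
    · exact absurd rfl hab
    · exact disjoint_singleton_left.2 (by simp)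
    · exact disjoint_singleton_right.2 (by simp)
    · exact (disjoint_image_iff (Option.some_injective _)).2
        (hM.disj a b fun e => hab (congrArg some e))
  · have key : ∀ b, (b = x ∨ (H.Adj x b ∧ (θ ∘ nb) b ∈ uIcc ((θ ∘ nb) u) ((θ ∘ nb) v))) →
        ∃ q ∈ B b, q = y ∨ (K.Adj y q ∧ θ q ∈ uIcc (θ (nb u)) (θ (nb v))) := by
      rintro b (rfl | ⟨hb, hb'⟩)
      · exact ⟨y, hyx, Or.inl rfl⟩
      · exact ⟨nb b, (hnb b hb).1, Or.inr ⟨(hnb b hb).2, hb'⟩⟩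
    rintro (_ | a) (_ | b) hab
    · exact hab.elim
    · obtain ⟨q, hq, h⟩ := key b hab
      exact ⟨none, rfl, some q, mem_image_of_mem _ hq, h⟩
    · obtain ⟨q, hq, h⟩ := key a hab
      exact ⟨some q, mem_image_of_mem _ hq, none, rfl, h⟩
    · obtain ⟨hab, h1, h2⟩ := hab
      by_cases ha : a = x
      · subst ha
        exact ⟨some y, mem_image_of_mem _ hyx, some (nb b), mem_image_of_mem _ (hnb b hab).1,
          (hnb b hab).2, fun _ => h1 rfl, fun e => absurd e (hnb b hab).2.ne'⟩
      by_cases hb : b = x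
      · subst hb
        exact ⟨some (nb a), mem_image_of_mem _ (hnb a hab.symm).1, some y, mem_image_of_mem _ hyx,
          (hnb a hab.symm).2.symm, fun e => absurd e (hnb a hab.symm).2.ne', fun _ => h2 rfl⟩
      · obtain ⟨p, hp, q, hq, hpq⟩ := hM.adj a b hab
        refine ⟨some p, mem_image_of_mem _ hp, some q, mem_image_of_mem _ hq, hpq, ?_, ?_⟩
        · rintro rfl
          exact absurd (hyB a hp) ha
        · rintro rfl
          exact absurd (hyB b hq) hb

open Classical in
/-- Two parts of a straight-line drawing that are not joined by an edge can be joined by one. -/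
theorem IsStraight.exists_join {X : Type*} [Finite X] {K : SimpleGraph X} (hK : IsStraight K)
    {A : Set X} (hA : A.Nonempty) (hA' : Aᶜ.Nonempty) (h : ∀ a ∈ A, ∀ b ∉ A, ¬ K.Adj a b) :
    ∃ p ∈ A, ∃ q ∉ A, IsStraight (K ⊔ SimpleGraph.edge p q) := by
  obtain ⟨D⟩ := hK
  obtain ⟨p, hp, hpmax⟩ := exists_max_image A (fun z => (D.pos z).re) (toFinite A) hA
  obtain ⟨q, hq, hqmin⟩ := exists_min_image Aᶜ (fun z => (D.pos z).re) (toFinite Aᶜ) hA'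
  refine ⟨p, hp, q, hq, ?_⟩
  -- Everything outside `A` is translated so as to begin one unit to the right of `A`. This leaves
  -- an empty strip, across which a rightmost point of `A` is joined to a leftmost point of the
  -- rest.
  set τ : ℂ := (((D.pos p).re - (D.pos q).re + 1 : ℝ) : ℂ) with hτ
  let P : X → ℂ := fun z => if z ∈ A then D.pos z else τ + D.pos z
  have hPA : ∀ z ∈ A, P z = D.pos z := fun z hz => if_pos hz
  have hPA' : ∀ z ∉ A, P z = τ + D.pos z := fun z hz => if_neg hz
  set M := (P p).re with hM
  have hMp : M = (D.pos p).re := by rw [hM, hPA p hp]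
  have hle : ∀ z ∈ A, (P z).re ≤ M := fun z hz => by
    rw [hPA z hz, hMp]; exact hpmax z hz
  have hge : ∀ z ∉ A, M + 1 ≤ (P z).re := fun z hz => by
    rw [hPA' z hz, hMp, hτ, Complex.add_re, Complex.ofReal_re]
    have : (D.pos q).re ≤ (D.pos z).re := hqmin z hz
    linarith
  have hMq : (P q).re = M + 1 := by
    rw [hPA' q hq, hMp, hτ, Complex.add_re, Complex.ofReal_re]
    ring
  have hside : ∀ a b, K.Adj a b → (a ∈ A ∧ b ∈ A) ∨ (a ∉ A ∧ b ∉ A) := by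
    intro a b hab
    by_cases ha : a ∈ A
    · by_cases hb : b ∈ A
      · exact Or.inl ⟨ha, hb⟩
      · exact absurd hab (h a ha b hb)
    · by_cases hb : b ∈ A
      · exact absurd hab.symm (h b hb a ha)
      · exact Or.inr ⟨ha, hb⟩
  have hsegle : ∀ a ∈ A, ∀ b ∈ A, ∀ z ∈ segment ℝ (P a) (P b), z.re ≤ M := fun a ha b hb z hz =>
    (convex_halfSpace_re_le M).segment_subset (hle a ha) (hle b hb) hz
  have hsegge : ∀ a ∉ A, ∀ b ∉ A, ∀ z ∈ segment ℝ (P a) (P b), M + 1 ≤ z.re :=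
    fun a ha b hb z hz => (convex_halfSpace_re_ge (M + 1)).segment_subset (hge a ha) (hge b hb) hz
  have hpq : ∀ z ∈ segment ℝ (P p) (P q), (z.re ≤ M → z = P p) ∧ (M + 1 ≤ z.re → z = P q) := by
    rintro z ⟨s, t, hs, ht, hst, rfl⟩
    have hre : (s • P p + t • P q).re = M + t := by
      simp only [Complex.add_re, Complex.real_smul, Complex.re_ofReal_mul, hMq, ← hM]
      obtain rfl : s = 1 - t := by linarith
      ring
    rw [hre]
    constructor
    · intro h1
      obtain rfl : t = 0 := by linarith
      obtain rfl : s = 1 := by linarith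
      simp
    · intro h1
      obtain rfl : s = 0 := by linarith
      obtain rfl : t = 1 := by linarith
      simp
  have hinj : Function.Injective P := by
    intro a b hab
    by_cases ha : a ∈ A <;> by_cases hb : b ∈ A
    · rw [hPA a ha, hPA b hb] at hab; exact D.inj hab
    · have := hle a ha; have := hge b hb; rw [hab] at *; linarith
    · have := hge a ha; have := hle b hb; rw [hab] at *; linarith
    · rw [hPA' a ha, hPA' b hb] at hab; exact D.inj (add_left_cancel hab)
  have hnm : ∀ a b v, K.Adj a b → v ≠ a → v ≠ b → P v ∉ segment ℝ (P a) (P b) := by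
    intro a b v hab hva hvb hmem
    obtain ⟨ha, hb⟩ | ⟨ha, hb⟩ := hside a b hab <;> by_cases hv : v ∈ A
    · rw [hPA a ha, hPA b hb, hPA v hv] at hmem
      exact D.notMem a b v hab hva hvb hmem
    · have := hsegle a ha b hb _ hmem; have := hge v hv; linarith
    · have := hsegge a ha b hb _ hmem; have := hle v hv; linarith
    · rw [hPA' a ha, hPA' b hb, hPA' v hv, mem_segment_translate] at hmem
      exact D.notMem a b v hab hva hvb hmem
  have hnmpq : ∀ v, v ≠ p → v ≠ q → P v ∉ segment ℝ (P p) (P q) := by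
    intro v hvp hvq hmem
    by_cases hv : v ∈ A
    · exact hvp (hinj ((hpq _ hmem).1 (hle v hv)))
    · exact hvq (hinj ((hpq _ hmem).2 (hge v hv)))
  have hdj : ∀ a b, K.Adj a b → a ≠ p → a ≠ q → b ≠ p → b ≠ q →
      Disjoint (segment ℝ (P a) (P b)) (segment ℝ (P p) (P q)) := by
    intro a b hab h1 h2 h3 h4
    rw [Set.disjoint_left]
    intro z hz hz'
    obtain ⟨ha, hb⟩ | ⟨ha, hb⟩ := hside a b hab
    · have := (hpq z hz').1 (hsegle a ha b hb z hz)
      subst this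
      exact hnm a b p hab h1.symm h3.symm hz
    · have := (hpq z hz').2 (hsegge a ha b hb z hz)
      subst this
      exact hnm a b q hab h2.symm h4.symm hz
  have hedge : ∀ a b, (SimpleGraph.edge p q).Adj a b → (a = p ∧ b = q) ∨ (a = q ∧ b = p) := by
    intro a b hab
    rw [SimpleGraph.edge_adj] at hab
    exact hab.1
  refine ⟨⟨P, hinj, ?_, ?_⟩⟩
  · rintro a b v (hab | hab) hva hvb
    · exact hnm a b v hab hva hvb
    · obtain ⟨rfl, rfl⟩ | ⟨rfl, rfl⟩ := hedge a b hab
      · exact hnmpq v hva hvb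
      · rw [segment_symm]; exact hnmpq v hvb hva
  · rintro a b c d (hab | hab) (hcd | hcd) h1 h2 h3 h4
    · rw [Set.disjoint_left]
      intro z hz hz'
      obtain ⟨ha, hb⟩ | ⟨ha, hb⟩ := hside a b hab <;>
        obtain ⟨hc, hd⟩ | ⟨hc, hd⟩ := hside c d hcd
      · rw [hPA a ha, hPA b hb] at hz
        rw [hPA c hc, hPA d hd] at hz'
        exact Set.disjoint_left.1 (D.disj a b c d hab hcd h1 h2 h3 h4) hz hz'
      · have := hsegle a ha b hb z hz; have := hsegge c hc d hd z hz'; linarith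
      · have := hsegge a ha b hb z hz; have := hsegle c hc d hd z hz'; linarith
      · rw [hPA' a ha, hPA' b hb, ← segment_translate_image] at hz
        rw [hPA' c hc, hPA' d hd, ← segment_translate_image] at hz'
        obtain ⟨w, hw, rfl⟩ := hz
        obtain ⟨w', hw', e⟩ := hz'
        obtain rfl := add_left_cancel e
        exact Set.disjoint_left.1 (D.disj a b c d hab hcd h1 h2 h3 h4) hw hw'
    · obtain ⟨rfl, rfl⟩ | ⟨rfl, rfl⟩ := hedge c d hcd
      · exact hdj a b hab h1 h2 h3 h4
      · rw [segment_symm ℝ (P c)]; exact hdj a b hab h2 h1 h4 h3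
    · obtain ⟨rfl, rfl⟩ | ⟨rfl, rfl⟩ := hedge a b hab
      · exact (hdj c d hcd h1.symm h3.symm h2.symm h4.symm).symm
      · rw [segment_symm ℝ (P a)]
        exact (hdj c d hcd h3.symm h1.symm h4.symm h2.symm).symm
    · exfalso
      obtain ⟨rfl, rfl⟩ | ⟨rfl, rfl⟩ := hedge a b hab <;>
        obtain ⟨rfl, rfl⟩ | ⟨rfl, rfl⟩ := hedge c d hcd
      · exact h1 rfl
      · exact h2 rfl
      · exact h2 rfl
      · exact h1 rfl

theorem isMinor_sup_edge {V X : Type*} {G : SimpleGraph V} {K L : SimpleGraph X} {A B : V → Set X}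
    (h : CoreModel G K A B) (hKL : K ≤ L) {u v : V} {p q : X} (hp : p ∈ B u) (hq : q ∈ B v)
    (hpq : L.Adj p q) : IsMinor (G ⊔ SimpleGraph.edge u v) L := by
  refine ⟨B, fun w => (h.conn w).mono fun _ _ hab => hKL hab, h.disj, ?_⟩
  rintro a b (hab | hab)
  · obtain ⟨x, hx, y, hy, hxy⟩ := h.adj a b hab
    exact ⟨x, hx, y, hy, hKL hxy⟩
  · rw [SimpleGraph.edge_adj] at hab
    obtain ⟨⟨rfl, rfl⟩ | ⟨rfl, rfl⟩, -⟩ := hab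
    · exact ⟨p, hp, q, hq, hpq⟩
    · exact ⟨q, hq, p, hp, hpq.symm⟩

/-- The branch sets of the straight model cover all its vertices, so `A` induces a partition of the
model. An edge of the model across this partition serves as it is; if there is none, one is added.
-/
theorem IsPlanar.exists_join {V : Type*} [Finite V] {H : SimpleGraph V} (hH : IsPlanar H)
    {A : Set V} (hA : A.Nonempty) (hA' : Aᶜ.Nonempty) :
    ∃ a ∈ A, ∃ b ∉ A, IsPlanar (H ⊔ SimpleGraph.edge a b) := by
  obtain ⟨D⟩ := hH
  obtain ⟨a₀, ha₀⟩ := hA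
  obtain ⟨b₀, hb₀⟩ := hA'
  obtain ⟨X, _, K, B, hK, hM, hcov, -⟩ := D.exists_straight_model a₀
  set Y : Set X := ⋃ v ∈ A, B v with hY
  have hYin : ∀ p ∈ Y, ∃ a ∈ A, p ∈ B a := fun p hp => by simpa [hY] using hp
  have hYout : ∀ q ∉ Y, ∃ b ∉ A, q ∈ B b := by
    intro q hq
    obtain ⟨b, hb⟩ := hcov q
    exact ⟨b, fun hbA => hq (mem_iUnion₂.2 ⟨b, hbA, hb⟩), hb⟩
  have hne : Y.Nonempty := by
    obtain ⟨x, hx⟩ := (induce_connected_iff.1 (hM.conn a₀)).1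
    exact ⟨x, mem_iUnion₂.2 ⟨a₀, ha₀, hx⟩⟩
  have hne' : Yᶜ.Nonempty := by
    obtain ⟨x, hx⟩ := (induce_connected_iff.1 (hM.conn b₀)).1
    refine ⟨x, fun hxY => ?_⟩
    obtain ⟨a, ha, hxa⟩ := hYin x hxY
    exact hb₀ (hM.eq_of_mem hx hxa ▸ ha)
  obtain ⟨p, hp, q, hq, L, hKL, hL, hpq⟩ : ∃ p ∈ Y, ∃ q ∉ Y, ∃ L : SimpleGraph X, K ≤ L ∧
      IsStraight L ∧ L.Adj p q := by
    by_cases hex : ∃ p ∈ Y, ∃ q ∉ Y, K.Adj p q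
    · obtain ⟨p, hp, q, hq, hpq⟩ := hex
      exact ⟨p, hp, q, hq, K, le_rfl, hK, hpq⟩
    · push Not at hex
      obtain ⟨p, hp, q, hq, hL⟩ := hK.exists_join hne hne' hex
      exact ⟨p, hp, q, hq, _, le_sup_left, hL, Or.inr ((SimpleGraph.edge_adj ..).2
        ⟨Or.inl ⟨rfl, rfl⟩, fun e => hq (e ▸ hp)⟩)⟩
  obtain ⟨a, ha, hpa⟩ := hYin p hp
  obtain ⟨b, hb, hqb⟩ := hYout q hq
  exact ⟨a, ha, b, hb, hL.isPlanar_of_isMinor (isMinor_sup_edge hM hKL hpa hqb hpq)⟩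

/-! ### Maximal planar graphs -/

/-- `H` is planar, and no edge can be added to it. -/
structure IsMaximalPlanar {V : Type*} (H : SimpleGraph V) : Prop where
  planar : IsPlanar H
  adj : ∀ a b, a ≠ b → IsPlanar (H ⊔ SimpleGraph.edge a b) → H.Adj a b

theorem IsPlanar.exists_isMaximalPlanar {V : Type*} [Finite V] {G : SimpleGraph V}
    (hG : IsPlanar G) : ∃ H, G ≤ H ∧ IsMaximalPlanar H := by
  obtain ⟨H, hGH, hH⟩ := Finite.exists_le_maximal (p := fun H : SimpleGraph V => IsPlanar H) hG
  refine ⟨H, hGH, hH.prop, fun a b hab h => ?_⟩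
  exact hH.le_of_ge h le_sup_left (Or.inr ((SimpleGraph.edge_adj ..).2 ⟨Or.inl ⟨rfl, rfl⟩, hab⟩))

namespace IsMaximalPlanar

variable {V : Type*} [Finite V] {H : SimpleGraph V}

/-- A maximal planar graph is connected: some edge between the two parts could be added, so it is
already present. -/
theorem exists_leaving (hH : IsMaximalPlanar H) {A : Set V} (hA : A.Nonempty)
    (hA' : Aᶜ.Nonempty) : ∃ a ∈ A, ∃ b ∉ A, H.Adj a b := by
  obtain ⟨a, ha, b, hb, h⟩ := hH.planar.exists_join hA hA'
  exact ⟨a, ha, b, hb, hH.adj a b (fun e => hb (e ▸ ha)) h⟩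

theorem eq_univ_of_closed (hH : IsMaximalPlanar H) (T : Set V) (hT : T.Nonempty)
    (hcl : ∀ a ∈ T, ∀ b, H.Adj a b → b ∈ T) : T = univ := by
  by_contra hne
  obtain ⟨a, ha, b, hb, hab⟩ := hH.exists_leaving hT (nonempty_compl.2 hne)
  exact hb (hcl a ha b hab)

/-- Around each vertex there is an ordering of the neighbours in which consecutive neighbours are
adjacent. -/
theorem exists_order (hH : IsMaximalPlanar H) (x : V) : ∃ θ : V → ℝ,
    ∀ u ∈ H.neighborSet x, ∀ v ∈ H.neighborSet x, u ≠ v → θ u ≤ θ v →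
      (∀ z ∈ H.neighborSet x, z ≠ u → z ≠ v → θ z ≤ θ u ∨ θ v ≤ θ z) → H.Adj u v := by
  obtain ⟨θ, hinj, hs⟩ := hH.planar.exists_angle x
  refine ⟨θ, fun u hu v hv huv hle hz => ?_⟩
  refine hH.adj u v huv ((hs u hu v hv huv).of_isMinor ?_)
  rw [uIoo_of_le hle, uIcc_of_le hle]
  have hS : ∀ z ∈ H.neighborSet x, θ z ∉ Ioo (θ u) (θ v) := by
    rintro z hzx ⟨h1, h2⟩
    have := hz z hzx (by rintro rfl; exact h1.false) (by rintro rfl; exact h2.false)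
    obtain h | h := this <;> linarith
  -- No neighbour lies strictly between `u` and `v`, so the first copy of `x` keeps all its
  -- neighbours. The second copy is adjacent to `u` and `v`, and contracting it into `u` produces
  -- the edge from `u` to `v`.
  refine isMinor_splitVertex_of (u := u) (Or.inr ⟨hu, left_mem_Icc.2 hle⟩) ?_
  rintro a b (hab | hab)
  · left
    refine ⟨hab, ?_, ?_⟩
    · rintro rfl
      exact hS b hab
    · rintro rfl
      exact hS a hab.symm
  · right
    rw [SimpleGraph.edge_adj] at hab
    obtain ⟨⟨rfl, rfl⟩ | ⟨rfl, rfl⟩, -⟩ := hab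
    · exact Or.inl ⟨rfl, Or.inr ⟨hv, right_mem_Icc.2 hle⟩⟩
    · exact Or.inr ⟨rfl, Or.inr ⟨hv, right_mem_Icc.2 hle⟩⟩

/-- The first two neighbours of `x` in the angular order are consecutive, hence adjacent. -/
theorem exists_triangle_of_neighborSet (hH : IsMaximalPlanar H) {x y z : V} (hy : H.Adj x y)
    (hz : H.Adj x z) (hyz : y ≠ z) : ∃ u v, H.Adj x u ∧ H.Adj x v ∧ H.Adj u v := by
  obtain ⟨θ, hθ⟩ := hH.exists_order x
  obtain ⟨u, hu, humin⟩ := exists_min_image (H.neighborSet x) θ (toFinite _) ⟨y, hy⟩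
  have hne : (H.neighborSet x \ {u}).Nonempty := by
    by_cases h : y = u
    · exact ⟨z, hz, fun e => hyz (h.trans (mem_singleton_iff.1 e).symm)⟩
    · exact ⟨y, hy, h⟩
  obtain ⟨v, ⟨hv, hvu⟩, hvmin⟩ := exists_min_image _ θ (toFinite _) hne
  exact ⟨u, v, hu, hv, hθ u hu v hv (Ne.symm hvu) (humin v hv) fun w hw hwu _ =>
    Or.inr (hvmin w ⟨hw, hwu⟩)⟩

/-- The first three neighbours of `x` in the angular order form a path, which `x` closes to a
4-cycle. -/
theorem exists_four_cycle_of_neighborSet (hH : IsMaximalPlanar H) {x : V}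
    (hdeg : 3 ≤ (H.neighborSet x).ncard) :
    ∃ u v w, H.Adj x u ∧ H.Adj u v ∧ H.Adj v w ∧ H.Adj w x ∧ x ≠ v ∧ u ≠ w := by
  obtain ⟨θ, hθ⟩ := hH.exists_order x
  obtain ⟨u, hu, humin⟩ := exists_min_image (H.neighborSet x) θ (toFinite _)
    (nonempty_of_ncard_ne_zero (by omega))
  have h1 : (H.neighborSet x \ {u}).ncard + 1 = (H.neighborSet x).ncard :=
    ncard_sdiff_singleton_add_one hu
  obtain ⟨v, hv, hvmin⟩ := exists_min_image (H.neighborSet x \ {u}) θ (toFinite _)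
    (nonempty_of_ncard_ne_zero (by omega))
  have h2 : ((H.neighborSet x \ {u}) \ {v}).ncard + 1 = (H.neighborSet x \ {u}).ncard :=
    ncard_sdiff_singleton_add_one hv
  obtain ⟨w, hw, hwmin⟩ := exists_min_image ((H.neighborSet x \ {u}) \ {v}) θ (toFinite _)
    (nonempty_of_ncard_ne_zero (by omega))
  refine ⟨u, v, w, hu, ?_, ?_, hw.1.1.symm, hv.1.ne, fun e => hw.1.2 e.symm⟩
  · exact hθ u hu v hv.1 (fun e => hv.2 e.symm) (humin v hv.1) fun z hz hzu _ =>
      Or.inr (hvmin z ⟨hz, hzu⟩)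
  · refine hθ v hv.1 w hw.1.1 (fun e => hw.2 e.symm) (hvmin w hw.1) fun z hz hzv hzw => ?_
    by_cases hzu : z = u
    · subst hzu; exact Or.inl (humin v hv.1)
    · exact Or.inr (hwmin z ⟨⟨hz, hzu⟩, hzv⟩)

/-- By connectivity an edge leaves `{x}`, and another leaves the two ends of that edge; these two
edges share a vertex, which thus has two neighbours. -/
theorem exists_triangle (hH : IsMaximalPlanar H) (hV : 3 ≤ Nat.card V) :
    ∃ x u v, H.Adj x u ∧ H.Adj x v ∧ H.Adj u v := by
  have hout : ∀ A : Set V, A.ncard < Nat.card V → Aᶜ.Nonempty := fun A hA =>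
    nonempty_compl.2 fun h => by rw [h, ncard_univ] at hA; exact hA.false
  have : Nonempty V := Nat.card_pos_iff.1 (by omega) |>.1
  obtain ⟨x⟩ := this
  obtain ⟨x', hx', y, hyx, hxy⟩ := hH.exists_leaving (singleton_nonempty x)
    (hout _ (by rw [ncard_singleton]; omega))
  obtain rfl : x' = x := hx'
  have hle : ({x', y} : Set V).ncard ≤ 2 :=
    (ncard_insert_le _ _).trans (by rw [ncard_singleton])
  obtain ⟨a, ha, b, hb, hab⟩ := hH.exists_leaving (A := {x', y}) ⟨x', Or.inl rfl⟩
    (hout _ (by omega))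
  obtain rfl | rfl := ha
  · exact ⟨a, hH.exists_triangle_of_neighborSet hxy hab fun e => hb (Or.inr e.symm)⟩
  · exact ⟨a, hH.exists_triangle_of_neighborSet hxy.symm hab fun e => hb (Or.inl e.symm)⟩

/-- By connectivity an edge leaves a triangle; its end on the triangle has degree at least three. -/
theorem exists_four_cycle (hH : IsMaximalPlanar H) (hV : 4 ≤ Nat.card V) :
    ∃ x u v w, H.Adj x u ∧ H.Adj u v ∧ H.Adj v w ∧ H.Adj w x ∧ x ≠ v ∧ u ≠ w := by
  obtain ⟨x, u, v, hxu, hxv, huv⟩ := hH.exists_triangle (by omega)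
  have hle : ({x, u, v} : Set V).ncard ≤ 3 := by
    have h1 := ncard_insert_le x {u, v}
    have h2 := ncard_insert_le u {v}
    rw [ncard_singleton] at h2
    omega
  obtain ⟨a, ha, b, hb, hab⟩ := hH.exists_leaving (A := {x, u, v}) ⟨x, Or.inl rfl⟩
    (nonempty_compl.2 fun h => by rw [h, ncard_univ] at hle; omega)
  have key : ∀ c d, H.Adj a c → H.Adj a d → c ≠ d → c ≠ b → d ≠ b →
      ∃ x u v w, H.Adj x u ∧ H.Adj u v ∧ H.Adj v w ∧ H.Adj w x ∧ x ≠ v ∧ u ≠ w := by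
    intro c d hc hd hcd hcb hdb
    exact ⟨a, hH.exists_four_cycle_of_neighborSet
      ((two_lt_ncard (toFinite _)).2 ⟨c, hc, d, hd, b, hab, hcd, hcb, hdb⟩)⟩
  have hne : ∀ c ∈ ({x, u, v} : Set V), c ≠ b := fun c hc e => hb (e ▸ hc)
  have hx := hne x (Or.inl rfl)
  have hu := hne u (Or.inr (Or.inl rfl))
  have hv := hne v (Or.inr (Or.inr rfl))
  obtain rfl | rfl | rfl := ha
  · exact key u v hxu hxv huv.ne hu hv
  · exact key x v hxu.symm huv hxv.ne hx hv
  · exact key x u hxv.symm huv.symm hxu.ne hx hu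

end IsMaximalPlanar

/-! ### Growing a cycle -/

/-- The vertices of the list `l` form a cycle of `H` in this order. -/
structure IsCycleList {W : Type*} (H : SimpleGraph W) (l : List W) : Prop where
  nodup : l.Nodup
  three_le : 3 ≤ l.length
  chain : Cycle.Chain H.Adj (l : Cycle W)

namespace IsCycleList

variable {W : Type*} {H : SimpleGraph W} {l : List W}

theorem exists_cons (h : IsCycleList H l) {x : W} (hx : x ∈ l) :
    ∃ r, IsCycleList H (x :: r) ∧ (x :: r).length = l.length ∧ ∀ z, z ∈ x :: r ↔ z ∈ l := by
  obtain ⟨s, t, rfl⟩ := List.append_of_mem hx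
  have hrot : (s ++ x :: t) ~r (x :: (t ++ s)) := List.isRotated_append
  refine ⟨t ++ s, ⟨hrot.nodup_iff.1 h.nodup, ?_, ?_⟩, hrot.perm.length_eq.symm,
    fun z => hrot.mem_iff.symm⟩
  · rw [← hrot.perm.length_eq]; exact h.three_le
  · rw [← Cycle.coe_eq_coe.2 hrot]; exact h.chain

theorem of_cons {x : W} {r : List W} (h : IsCycleList H (x :: r)) :
    ∃ a b, r.head? = some a ∧ r.getLast? = some b ∧ a ≠ b ∧ H.Adj x a ∧ H.Adj b x ∧
      r.IsChain H.Adj := by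
  have hlen := h.three_le
  have hch := h.chain
  have hnd := h.nodup
  rw [Cycle.chain_coe_cons] at hch
  match r, hlen with
  | a :: c :: t, _ =>
    have h2 : ((a :: c :: t) ++ [x]).IsChain H.Adj := (List.isChain_cons_cons.1 hch).2
    replace h2 := List.isChain_append.1 h2
    refine ⟨a, (c :: t).getLast (by simp), rfl, ?_, ?_, ?_, ?_, ?_⟩
    · rw [List.getLast?_cons_cons, List.getLast?_eq_getLast_of_ne_nil]
    · intro e
      have := List.getLast_mem (l := c :: t) (by simp)
      rw [← e] at this
      simp only [List.nodup_cons] at hnd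
      exact hnd.2.1 this
    · simp only [List.cons_append, List.isChain_cons_cons] at hch
      exact hch.1
    · refine h2.2.2 _ ?_ x rfl
      rw [List.getLast?_cons_cons, List.getLast?_eq_getLast_of_ne_nil]
      rfl
    · exact h2.1

theorem exists_isCycle (h : IsCycleList H l) :
    ∃ (x : W) (p : H.Walk x x), p.IsCycle ∧ p.length = l.length := by
  have hlen := h.three_le
  have hch := h.chain
  have hnd := h.nodup
  match l, hlen with
  | x :: a :: c :: t, _ =>
    rw [Cycle.chain_coe_cons] at hch
    have hch2 : ((a :: c :: t) ++ [x]).IsChain H.Adj := (List.isChain_cons_cons.1 hch).2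
    have hxa : H.Adj x a := (List.isChain_cons_cons.1 hch).1
    let q := SimpleGraph.Walk.ofSupport _ (by simp) hch2
    have hq : q.support = (a :: c :: t) ++ [x] := SimpleGraph.Walk.support_ofSupport _ _
    let q' : H.Walk a x := q.copy rfl (by simp)
    have hq' : q'.support = (a :: c :: t) ++ [x] := (SimpleGraph.Walk.support_copy ..).trans hq
    have hlen' : q'.length = t.length + 2 := by
      have := q'.length_support
      rw [hq'] at this
      simp at this
      omega
    have hpath : q'.IsPath := by
      rw [SimpleGraph.Walk.isPath_def, hq']
      exact ((List.perm_append_singleton x (a :: c :: t)).nodup_iff).2 hnd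
    refine ⟨x, SimpleGraph.Walk.cons hxa q', ?_, ?_⟩
    · refine (SimpleGraph.Walk.cons_isCycle_iff _ _).2 ⟨hpath, fun hmem => ?_⟩
      have := hpath.length_eq_one_of_mem_edges (by rwa [Sym2.eq_swap])
      omega
    · simp [hlen']

theorem mono {H' : SimpleGraph W} (h : IsCycleList H l) (hle : H ≤ H') : IsCycleList H' l :=
  ⟨h.nodup, h.three_le, h.chain.imp fun _ _ hab => hle hab⟩

/-- Replacing a vertex `x` of a cycle, with neighbours `a` and `b`, by a path `q, w, p`. -/
theorem replace {W' : Type*} {H' : SimpleGraph W'} {x : W} {r : List W}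
    (h : IsCycleList H (x :: r)) (f : W → W') (hf : Function.Injective f)
    (hadj : ∀ c ∈ r, ∀ d ∈ r, H.Adj c d → H'.Adj (f c) (f d)) {p q w : W'}
    (hp : p ∉ r.map f) (hq : q ∉ r.map f) (hw : w ∉ r.map f)
    (hpa : ∀ a, r.head? = some a → H'.Adj p (f a)) (hbq : ∀ b, r.getLast? = some b → H'.Adj (f b) q)
    (hqw : H'.Adj q w) (hwp : H'.Adj w p) (hpq : p ≠ q) :
    IsCycleList H' (p :: (r.map f ++ [q, w])) := by
  obtain ⟨a, b, ha, hb, -, -, -, hch⟩ := h.of_cons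
  have hlen := h.three_le
  refine ⟨?_, ?_, ?_⟩
  · have h1 : (r.map f).Nodup := (List.nodup_cons.1 h.nodup).2.map hf
    have h2 : [q, w].Nodup := by simp [hqw.ne]
    have h3 : (r.map f ++ [q, w]).Nodup := by
      refine List.Nodup.append h1 h2 ?_
      intro z hz hz'
      simp only [List.mem_cons, List.not_mem_nil, or_false] at hz'
      obtain rfl | rfl := hz'
      · exact hq hz
      · exact hw hz
    refine List.nodup_cons.2 ⟨?_, h3⟩
    simp only [List.mem_append, List.mem_cons, List.not_mem_nil, or_false, not_or]
    exact ⟨hp, hpq, hwp.ne'⟩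
  · simp only [List.length_cons, List.length_append, List.length_map] at hlen ⊢
    omega
  · rw [Cycle.chain_coe_cons]
    have h1 : (r.map f).IsChain H'.Adj := by
      rw [List.isChain_map]
      exact hch.imp_of_mem_imp fun c d hc hd hcd => hadj c hc d hd hcd
    have h2 : ([q, w] ++ [p]).IsChain H'.Adj := by simp [hqw, hwp]
    have h3 : (r.map f ++ ([q, w] ++ [p])).IsChain H'.Adj := by
      refine List.isChain_append.2 ⟨h1, h2, ?_⟩
      intro y hy z hz
      rw [List.getLast?_map, hb] at hy
      obtain rfl : f b = y := by simpa using hy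
      obtain rfl : q = z := by simpa using hz
      exact hbq b hb
    rw [List.append_assoc]
    refine List.isChain_cons.2 ⟨?_, h3⟩
    intro y hy
    rw [List.head?_append, List.head?_map, ha] at hy
    obtain rfl : f a = y := by simpa using hy
    exact hpa a ha

end IsCycleList

theorem exists_cycleList_of_isCycle {V : Type*} {G : SimpleGraph V} {v : V} {p : G.Walk v v}
    (hp : p.IsCycle) : ∃ l, IsCycleList G l ∧ l.length = p.toSubgraph.verts.ncard := by
  classical
  cases p with
  | nil => exact absurd rfl hp.ne_nil
  | cons hadj q =>
    have hlen := hp.three_le_length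
    have hqlen := q.length_support
    have hsup : q.support ≠ [] := q.support_ne_nil
    have hlast : q.support.getLast hsup = v := q.getLast_support
    -- The support of `q` ends in the base vertex; moving that vertex to the front gives the cyclic
    -- list.
    have hsplit : q.support.dropLast ++ [v] = q.support := by
      conv_rhs => rw [← List.dropLast_append_getLast hsup, hlast]
    generalize q.support.dropLast = s at hsplit
    have hnd : q.support.Nodup := hp.support_nodup
    have hnd' : (v :: s).Nodup := by
      rw [← hsplit] at hnd
      exact (List.perm_append_singleton v s).nodup_iff.1 hnd
    refine ⟨v :: s, ⟨hnd', ?_, ?_⟩, ?_⟩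
    · simp only [SimpleGraph.Walk.length_cons] at hlen
      rw [← hsplit, List.length_append, List.length_singleton] at hqlen
      rw [List.length_cons]
      omega
    · rw [Cycle.chain_coe_cons, hsplit]
      exact (SimpleGraph.Walk.cons hadj q).isChain_adj_support
    · rw [← List.toFinset_card_of_nodup hnd', ← ncard_coe_finset]
      congr 1
      ext z
      rw [SimpleGraph.Walk.mem_verts_toSubgraph, SimpleGraph.Walk.support_cons, ← hsplit]
      simp [or_comm]

/-- Here `m` is the number of vertices off the cycle, and the hypothesis on closed sets is
connectivity. A split adds one vertex to the graph and two to the cycle, so `m` drops by one while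
the sum of the order and `m` does not change. -/
theorem exists_hamiltonian_of_cycleList (m : ℕ) :
    ∀ {W : Type*} [Finite W] {H : SimpleGraph W} {l : List W}, IsPlanar H →
      (∀ T : Set W, T.Nonempty → (∀ a ∈ T, ∀ b, H.Adj a b → b ∈ T) → T = univ) →
      IsCycleList H l → Nat.card W = l.length + m →
      ∃ H' : SimpleGraph (Fin (Nat.card W + m)), IsPlanar H' ∧ H'.IsHamiltonian ∧
        IsMinor H H' := by
  induction m with
  | zero =>
    intro W _ H l hH hconn hl hcard
    obtain ⟨x, p, hp, hlen⟩ := hl.exists_isCycle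
    let e : W ≃ Fin (Nat.card W + 0) := Finite.equivFin W
    refine ⟨H.comap e.symm, ?_, fun _ => ?_, ?_⟩
    · exact hH.of_isMinor (isMinor_of_injective e.symm e.symm.injective fun _ _ h => h)
    · let f : H →g H.comap e.symm := ⟨e, fun {a b} hab => by simpa using hab⟩
      refine ⟨e x, p.map f, ?_⟩
      rw [SimpleGraph.Walk.isHamiltonianCycle_iff_isCycle_and_length_eq]
      refine ⟨hp.map e.injective, ?_⟩
      rw [SimpleGraph.Walk.length_map, hlen, Fintype.card_fin]
      omega
    · exact isMinor_of_injective e e.injective fun a b hab => by simpa using hab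
  | succ m ih =>
    intro W _ H l hH hconn hl hcard
    have hlen := hl.three_le
    obtain ⟨x, hx, w, hw, hxw⟩ : ∃ x ∈ l, ∃ w, w ∉ l ∧ H.Adj x w := by
      by_contra! hno
      have hne : {a | a ∈ l}.Nonempty := ⟨l[0], List.getElem_mem _⟩
      have := hconn {a | a ∈ l} hne fun a ha b hab => by
        by_contra hb
        exact hno a ha b hb hab
      classical
      have h2 : ({a | a ∈ l} : Set W).ncard = l.length := by
        rw [← List.toFinset_card_of_nodup hl.nodup, ← ncard_coe_finset]
        congr 1
        ext; simp
      rw [this, ncard_univ] at h2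
      omega
    obtain ⟨r, hr, hrlen, hrmem⟩ := hl.exists_cons hx
    obtain ⟨a, b, ha, hb, hab, hxa, hbx, -⟩ := hr.of_cons
    have har : a ∈ r := List.mem_of_mem_head? ha
    have hbr : b ∈ r := List.mem_of_mem_getLast? hb
    have hxr : x ∉ r := (List.nodup_cons.1 hr.nodup).1
    have hwr : w ∉ r := fun h => hw ((hrmem w).1 (List.mem_cons_of_mem _ h))
    have hwa : w ≠ a := fun e => hwr (e ▸ har)
    -- The vertex `x` is split along its edges to `w` and to its successor `a` on the cycle. As end
    -- points of the angular interval, `w` and `a` become adjacent to both copies.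
    obtain ⟨θ, -, hs⟩ := hH.exists_angle x
    have hplan := hs w hxw a hxa hwa
    set S : Set W := {z | θ z ∉ uIoo (θ w) (θ a)} with hS
    set T : Set W := {z | θ z ∈ uIcc (θ w) (θ a)} with hT
    have hend : ∀ α β : ℝ, α ∉ uIoo α β ∧ β ∉ uIoo α β := by
      intro α β
      simp only [uIoo, mem_Ioo, inf_lt_left, inf_lt_right, lt_sup_iff, lt_irrefl]
      grind
    have hwS : w ∈ S := (hend _ _).1
    have haS : a ∈ S := (hend _ _).2
    have hwT : w ∈ T := left_mem_uIcc
    have haT : a ∈ T := right_mem_uIcc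
    have hST : ∀ z, z ∈ S ∨ z ∈ T := fun z => by
      by_cases h : θ z ∈ uIoo (θ w) (θ a)
      · exact Or.inr (uIoo_subset_uIcc_self h)
      · exact Or.inl h
    set H' := splitVertex H x S T with hH'
    have hxx : H'.Adj none (some x) := Or.inl rfl
    have hconn' : ∀ Q : Set (Option W), Q.Nonempty → (∀ c ∈ Q, ∀ d, H'.Adj c d → d ∈ Q) →
        Q = univ := by
      intro Q hQ hcl
      have hxn : some x ∈ Q ↔ none ∈ Q := ⟨fun h => hcl _ h _ hxx.symm, fun h => hcl _ h _ hxx⟩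
      have huniv := hconn {c | some c ∈ Q} (by
          obtain ⟨_ | c, hc⟩ := hQ
          · exact ⟨x, hxn.2 hc⟩
          · exact ⟨c, hc⟩) (by
          intro c hc d hcd
          by_cases hcx : c = x
          · subst hcx
            obtain hd | hd := hST d
            · exact hcl _ hc _ ⟨hcd, fun _ => hd, fun e => absurd e hcd.ne'⟩
            · exact hcl _ (hxn.1 hc) _ (Or.inr ⟨hcd, hd⟩)
          by_cases hdx : d = x
          · subst hdx
            obtain hc' | hc' := hST c
            · exact hcl _ hc _ ⟨hcd, fun e => absurd e hcx, fun _ => hc'⟩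
            · exact hxn.2 (hcl _ hc _ (Or.inr ⟨hcd.symm, hc'⟩))
          · exact hcl _ hc _ ⟨hcd, fun e => absurd e hcx, fun e => absurd e hdx⟩)
      have hall : ∀ c, some c ∈ Q := fun c => by
        have : c ∈ {c | some c ∈ Q} := huniv ▸ mem_univ c
        exact this
      rw [eq_univ_iff_forall]
      rintro (_ | c)
      · exact hxn.1 (hall x)
      · exact hall c
    have hsome : ∀ c, c ∉ r → some c ∉ r.map some := by
      intro c hc h
      obtain ⟨d, hd, e⟩ := List.mem_map.1 h
      exact hc (Option.some_injective _ e ▸ hd)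
    have hnone : none ∉ r.map some := by simp
    have hadj : ∀ c ∈ r, ∀ d ∈ r, H.Adj c d → H'.Adj (some c) (some d) := fun c hc d hd hcd =>
      ⟨hcd, fun e => absurd (e ▸ hc) hxr, fun e => absurd (e ▸ hd) hxr⟩
    have hxS : ∀ z, H.Adj x z → z ∈ S → H'.Adj (some x) (some z) := fun z hz hzS =>
      ⟨hz, fun _ => hzS, fun e => absurd e hz.ne'⟩
    have hnT : ∀ z, H.Adj x z → z ∈ T → H'.Adj none (some z) := fun z hz hzT => Or.inr ⟨hz, hzT⟩
    -- The other cycle neighbour `b` is adjacent to at least one copy. That copy follows `b` on the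
    -- new cycle, then comes `w`, then the other copy, which leads to `a`.
    have hcyc : ∃ l', IsCycleList H' l' ∧ l'.length = l.length + 2 := by
      obtain hbS | hbT := hST b
      · refine ⟨_, hr.replace some (Option.some_injective _) hadj hnone (hsome x hxr)
          (hsome w hwr) ?_ ?_ (hxS w hxw hwS) (hnT w hxw hwT).symm (by simp), ?_⟩
        · intro a' ha'
          obtain rfl : a = a' := by simpa [ha] using ha'
          exact hnT _ hxa haT
        · intro b' hb'
          obtain rfl : b = b' := by simpa [hb] using hb'
          exact (hxS _ hbx.symm hbS).symm
        · simp [← hrlen]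
      · refine ⟨_, hr.replace some (Option.some_injective _) hadj (hsome x hxr) hnone
          (hsome w hwr) ?_ ?_ (hnT w hxw hwT) (hxS w hxw hwS).symm (by simp), ?_⟩
        · intro a' ha'
          obtain rfl : a = a' := by simpa [ha] using ha'
          exact hxS _ hxa haS
        · intro b' hb'
          obtain rfl : b = b' := by simpa [hb] using hb'
          exact (hnT _ hbx.symm hbT).symm
        · simp [← hrlen]
    obtain ⟨l', hl', hl'len⟩ := hcyc
    have hcardO : Nat.card (Option W) = Nat.card W + 1 := Finite.card_option
    obtain ⟨H'', h1, h2, h3⟩ := ih hplan hconn' hl' (by omega)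
    have hminor : IsMinor H H'' := (isMinor_splitVertex fun z _ => hST z).trans h3
    have heq : Nat.card (Option W) + m = Nat.card W + (m + 1) := by omega
    rw [← heq]
    exact ⟨H'', h1, h2, hminor⟩

theorem IsMaximalPlanar.exists_hamiltonian {W : Type*} [Finite W] {H : SimpleGraph W}
    (hH : IsMaximalPlanar H) {l : List W} (hl : IsCycleList H l) :
    ∃ (N : ℕ) (H' : SimpleGraph (Fin N)), N + l.length = 2 * Nat.card W ∧ IsPlanar H' ∧
      H'.IsHamiltonian ∧ IsMinor H H' := by
  have hle : l.length ≤ Nat.card W := by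
    classical
    have := Fintype.ofFinite W
    rw [Nat.card_eq_fintype_card]
    exact hl.nodup.length_le_card
  obtain ⟨m, hm⟩ := Nat.exists_eq_add_of_le hle
  obtain ⟨H', h⟩ := exists_hamiltonian_of_cycleList m hH.planar hH.eq_univ_of_closed hl hm
  exact ⟨_, H', by omega, h⟩

theorem isCycleList_triangle {W : Type*} {H : SimpleGraph W} {x u v : W} (h1 : H.Adj x u)
    (h2 : H.Adj x v) (h3 : H.Adj u v) : IsCycleList H [x, u, v] :=
  ⟨by simp [h1.ne, h2.ne, h3.ne], by simp, by
    rw [Cycle.chain_coe_cons]; simp [h1, h3, h2.symm]⟩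

theorem isCycleList_four {W : Type*} {H : SimpleGraph W} {x u v w : W} (h1 : H.Adj x u)
    (h2 : H.Adj u v) (h3 : H.Adj v w) (h4 : H.Adj w x) (hxv : x ≠ v) (huw : u ≠ w) :
    IsCycleList H [x, u, v, w] :=
  ⟨by simp [h1.ne, h2.ne, h3.ne, h4.ne', hxv, huw], by simp, by
    rw [Cycle.chain_coe_cons]; simp [h1, h2, h3, h4]⟩

/-- A planar graph with at least four vertices is a minor of a planar Hamiltonian graph with
`2 n - 4` vertices. -/
theorem IsPlanar.exists_hamiltonian_four {V : Type*} [Finite V] {G : SimpleGraph V}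
    (hG : IsPlanar G) (hV : 4 ≤ Nat.card V) :
    ∃ (N : ℕ) (H : SimpleGraph (Fin N)), N + 4 = 2 * Nat.card V ∧ IsPlanar H ∧
      H.IsHamiltonian ∧ IsMinor G H := by
  obtain ⟨M, hGM, hM⟩ := hG.exists_isMaximalPlanar
  obtain ⟨x, u, v, w, h1, h2, h3, h4, h5, h6⟩ := hM.exists_four_cycle hV
  obtain ⟨N, H, hN, hH, hham, hmin⟩ := hM.exists_hamiltonian (isCycleList_four h1 h2 h3 h4 h5 h6)
  exact ⟨N, H, hN, hH, hham, (isMinor_of_le hGM).trans hmin⟩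

theorem IsPlanar.exists_hamiltonian_three {V : Type*} [Finite V] {G : SimpleGraph V}
    (hG : IsPlanar G) (hV : 3 ≤ Nat.card V) :
    ∃ (N : ℕ) (H : SimpleGraph (Fin N)), N + 3 = 2 * Nat.card V ∧ IsPlanar H ∧
      H.IsHamiltonian ∧ IsMinor G H := by
  obtain ⟨M, hGM, hM⟩ := hG.exists_isMaximalPlanar
  obtain ⟨x, u, v, h1, h2, h3⟩ := hM.exists_triangle hV
  obtain ⟨N, H, hN, hH, hham, hmin⟩ := hM.exists_hamiltonian (isCycleList_triangle h1 h2 h3)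
  exact ⟨N, H, hN, hH, hham, (isMinor_of_le hGM).trans hmin⟩

/-- Every graph on two vertices is a minor of a triangle. -/
theorem exists_hamiltonian_of_card_eq_two {V : Type*} [Finite V] (G : SimpleGraph V)
    (hV : Nat.card V = 2) :
    ∃ H : SimpleGraph (Fin 3), IsPlanar H ∧ H.IsHamiltonian ∧ IsMinor G H := by
  obtain ⟨M, -, hM⟩ := (isPlanar_bot 3).exists_isMaximalPlanar
  obtain ⟨x, u, v, h1, h2, h3⟩ := hM.exists_triangle (by simp)
  obtain ⟨N, H, hN, hH, hham, hmin⟩ := hM.exists_hamiltonian (isCycleList_triangle h1 h2 h3)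
  obtain rfl : N = 3 := by simp at hN; omega
  refine ⟨H, hH, hham, IsMinor.trans ?_ hmin⟩
  let e : V ≃ Fin 2 := Finite.equivFinOfCardEq hV
  have hne : ∀ a b : V, a ≠ b → M.Adj (![x, u] (e a)) (![x, u] (e b)) := by
    intro a b hab
    have := e.injective.ne hab
    generalize e a = i at *
    generalize e b = j at *
    fin_cases i <;> fin_cases j
    · exact absurd rfl this
    · exact h1
    · exact h1.symm
    · exact absurd rfl this
  exact isMinor_of_injective (fun a => ![x, u] (e a))
    (fun a b hab => by_contra fun h => (hne a b h).ne hab) fun a b hab => hne a b hab.ne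

/-- A graph on one vertex is a minor of the one-vertex graph. -/
theorem exists_hamiltonian_of_card_eq_one {V : Type*} [Finite V] (G : SimpleGraph V)
    (hV : Nat.card V = 1) :
    ∃ H : SimpleGraph (Fin 1), IsPlanar H ∧ H.IsHamiltonian ∧ IsMinor G H := by
  have : Subsingleton V := (Nat.card_eq_one_iff_unique.1 hV).1
  exact ⟨⊥, isPlanar_bot 1, fun h => absurd rfl h, isMinor_of_injective (fun _ => 0)
    (fun a b _ => Subsingleton.elim a b) fun a b hab => absurd (Subsingleton.elim a b) hab.ne⟩

end PlanarMinor

/-! ### Conclusion, by the kind of circuit. -/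

theorem proposition5 {V : Type*} [Fintype V] (G : SimpleGraph V) :
    (PlanarMinor.IsPlanar G →
      ∀ O : G.Subgraph, PlanarMinor.IsCircuit O → ¬ PlanarMinor.IsSeparating O →
        ¬ (Fintype.card V = 2 ∧ O.verts.ncard = 2) →
        ∃ (N : ℕ) (H : SimpleGraph (Fin N)),
          N + O.verts.ncard ≤ 2 * Fintype.card V ∧
          PlanarMinor.IsPlanar H ∧ H.IsHamiltonian ∧ PlanarMinor.IsMinor G H) ∧
    (PlanarMinor.IsTriangulation G → 4 ≤ Fintype.card V →
      ∃ (N : ℕ) (H : SimpleGraph (Fin N)),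
        N + 4 ≤ 2 * Fintype.card V ∧
        PlanarMinor.IsPlanar H ∧ H.IsHamiltonian ∧ PlanarMinor.IsMinor G H) := by
  rw [← Nat.card_eq_fintype_card]
  refine ⟨fun hG O hO _ hne => ?_, fun ⟨D, _⟩ hV => ?_⟩
  -- For a circuit with k ≤ 2 vertices a triangle of the maximal planar graph is used instead, and
  -- 2n - 3 < 2n - k. If n = 2, the host is a triangle, whose three vertices are within the bound 4
  -- - k exactly when k = 1.
  · have hsmall : ∀ v ∈ O.verts, O.verts.ncard ≤ 2 → ∃ (N : ℕ) (H : SimpleGraph (Fin N)),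
        N + O.verts.ncard ≤ 2 * Nat.card V ∧
        PlanarMinor.IsPlanar H ∧ H.IsHamiltonian ∧ PlanarMinor.IsMinor G H := by
      intro v hv hk
      have hle : O.verts.ncard ≤ Nat.card V := by
        rw [← Set.ncard_univ]
        exact Set.ncard_le_ncard (Set.subset_univ _)
      have hpos : 0 < O.verts.ncard := (Set.ncard_pos (Set.toFinite _)).2 ⟨v, hv⟩
      obtain h1 | h2 | h3 : Nat.card V = 1 ∨ Nat.card V = 2 ∨ 3 ≤ Nat.card V := by omega
      · obtain ⟨H, h⟩ := PlanarMinor.exists_hamiltonian_of_card_eq_one G h1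
        exact ⟨1, H, by omega, h⟩
      · obtain ⟨H, h⟩ := PlanarMinor.exists_hamiltonian_of_card_eq_two G h2
        exact ⟨3, H, by omega, h⟩
      · obtain ⟨N, H, hN, h⟩ := hG.exists_hamiltonian_three h3
        exact ⟨N, H, by omega, h⟩
    obtain ⟨v, rfl⟩ | ⟨u, v, huv, rfl⟩ | ⟨v, p, hp, rfl⟩ := hO
    · exact hsmall v rfl (by simp)
    · refine hsmall u (Or.inl rfl) ?_
      rw [SimpleGraph.subgraphOfAdj_verts, Set.ncard_pair huv.ne]
    · obtain ⟨l, hl, hlen⟩ := PlanarMinor.exists_cycleList_of_isCycle hp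
      obtain ⟨M, hGM, hM⟩ := hG.exists_isMaximalPlanar
      obtain ⟨N, H, hN, hH, hham, hmin⟩ := hM.exists_hamiltonian (hl.mono hGM)
      exact ⟨N, H, by omega, hH, hham, (PlanarMinor.isMinor_of_le hGM).trans hmin⟩
  · obtain ⟨N, H, hN, h⟩ := PlanarMinor.IsPlanar.exists_hamiltonian_four ⟨D⟩ hV
    exact ⟨N, H, hN.le, h⟩
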